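/- **Setting.** Let $\mathbb L^{n}_+=\{x\in\mathbb R^n : x_1\ge\|x_{2:n}\|\}$ be the second-order cone ($n\ge 1$, Euclidean norm), $\mathcal L=\mathbb L^{n_1}_+\times\dots\times\mathbb L^{n_p}_+$, $A=(A^1,\dots,A^p)$ with $A^i\in\mathbb R^{m\times n_i}$, $b\in\mathbb R^m$, and let $c,\bar c$ be block vectors. For $\epsilon\in\mathbb R$ consider $$(\mathrm P_\epsilon)\ \inf\{(c+\epsilon\bar c)^Tx : Ax=b,\ x\in\mathcal L\},\qquad (\mathrm D_\epsilon)\ \sup\{b^Ty : A^Ty+s=c+\epsilon\bar c,\ s\in\mathcal L\}.$$ Let $\psi(\epsilon)$ be the optimal value of $(\mathrm P_\epsilon)$, $\mathcal E=\{\epsilon:\psi(\epsilon)>-\infty\}$, $\mathcal P^*(\epsilon)$ the set of primal feasible $x$ with objective value $\psi(\epsilon)$, and $\mathcal D^*(\epsilon)$ the set of dual feasible $(y;s)$ with $b^Ty=\psi(\epsilon)$. Assume the interior point condition at $\epsilon=0$: there are feasible $x$ and $(y;s)$ for $(\mathrm P_0)$, $(\mathrm D_0)$ with $x^i,s^i\in\operatorname{int}\mathbb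 L^{n_i}_+$ for all $i$. The optimal partition $\pi(\epsilon)=(\mathcal B,\mathcal N,\mathcal R,(\mathcal T_1,\mathcal T_2,\mathcal T_3))$ consists of the sets of indices $i$ such that, respectively: $x^i_1>\|x^i_{2:n_i}\|$ for some $x\in\mathcal P^*(\epsilon)$; $s^i_1>\|s^i_{2:n_i}\|$ for some $(y;s)\in\mathcal D^*(\epsilon)$; $x^i_1=\|x^i_{2:n_i}\|>0$ and $s^i_1=\|s^i_{2:n_i}\|>0$ for some optimal $(x;y;s)$; $x^i=s^i=0$ for all optimal $(x;y;s)$; $s^i=0$ for all $(y;s)\in\mathcal D^*(\epsilon)$ and $x^i_1=\|x^i_{2:n_i}\|>0$ for some $x\in\mathcal P^*(\epsilon)$; $x^i=0$ for all $x\in\mathcal P^*(\epsilon)$ and $s^i_1=\|s^i_{2:n_i}\|>0$ for some $(y;s)\in\mathcal D^*(\epsilon)$. A solution $(x;y;s)$ is maximally complementary if $x\in\operatorname{ri}\mathcal P^*(\epsilon)$ and $(y;s)\in\operatorname{ri}\mathcal D^*(\epsilon)$. Let $R^i=\operatorname{diag}(1,-1,\dots,-1)\in\mathbb R^{n_i\times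 n_i}$ and let $L(x^i)=\begin{pmatrix}x^i_1&(x^i_{2:n_i})^T\\x^i_{2:n_i}&x^i_1I\end{pmatrix}$. Primal and dual nondegeneracy hold at $\epsilon$ if there is a maximally complementary solution $(x;y;s)$ at $\epsilon$ such that $\big((A^iP^i)_{\mathcal R\cup\mathcal T_2},(A^i)_{\mathcal B}\big)$ has full row rank, where the $n_i-1$ columns of $P^i$ are orthonormal eigenvectors for the positive eigenvalues of $L(x^i)$, and $\big((A^iR^is^i)_{\mathcal R\cup\mathcal T_3},(A^i)_{\mathcal B\cup\mathcal T_1\cup\mathcal T_2}\big)$ has full column rank. An *invariancy interval* is a nonempty open interval $J\subseteq\operatorname{int}\mathcal E$ on which $\pi$ is constant and the extreme rays of maximally complementary solutions, $\mathbb R_+x^i$ for $i\in\mathcal R\cup\mathcal T_2$ and $\mathbb R_+s^i$ for $i\in\mathcal R\cup\mathcal T_3$, do not vary. A *nonlinearity interval* is a nonempty open interval $J\subseteq\operatorname{int}\mathcal E$, maximal among the open subintervals of $\operatorname{int}\mathcal E$ on which $\pi$ is constant, such that some of these extreme rays does vary on $J$. Fix $\bar\epsilon\in\mathbb R$ and write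 $\bar{\mathcal B},\bar{\mathcal N},\bar{\mathcal R},\bar{\mathcal T}_1,\bar{\mathcal T}_2,\bar{\mathcal T}_3$ for the index sets of $\pi(\bar\epsilon)$. The nonlinear reformulation $(\mathrm{DN}_\epsilon)$ of the dual problem is to minimize $-b^Tw$ over $w\in\mathbb R^m$ and $z=(z^i)_{i\in\bar{\mathcal R}\cup\bar{\mathcal N}\cup\bar{\mathcal T}_3}$ subject to $(A^i)^Tw=c^i+\epsilon\bar c^i$ for $i\in\bar{\mathcal B}\cup\bar{\mathcal T}_1\cup\bar{\mathcal T}_2$; $(A^i)^Tw+z^i=c^i+\epsilon\bar c^i$ for $i\in\bar{\mathcal R}\cup\bar{\mathcal N}\cup\bar{\mathcal T}_3$; $(z^i)^TR^iz^i=0$ and $z^i_1>0$ for $i\in\bar{\mathcal R}\cup\bar{\mathcal T}_3$; $z^i\in\operatorname{int}\mathbb L^{n_i}_+$ for $i\in\bar{\mathcal N}$. With multipliers $u=(u^i)_{i=1}^p$ and $v=(v_i)_{i\in\bar{\mathcal R}\cup\bar{\mathcal T}_3}$ its first-order system $G((w;z;u;v),\epsilon)=0$ consists of $-\sum_iA^iu^i-b=0$;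 $-u^i-2v_iR^iz^i=0$ for $i\in\bar{\mathcal R}\cup\bar{\mathcal T}_3$; $-u^i=0$ for $i\in\bar{\mathcal N}$; and the three families of equality constraints above. A *solution map* on $(\bar\epsilon-\rho,\bar\epsilon+\rho)$, $\rho>0$, is a real analytic $\chi(\epsilon)=(w(\epsilon);z(\epsilon);u(\epsilon);v(\epsilon))$ with $G(\chi(\epsilon),\epsilon)=0$ on this interval such that $(w(\bar\epsilon);z(\bar\epsilon))$ is a globally optimal solution of $(\mathrm{DN}_{\bar\epsilon})$ (so that $u(\bar\epsilon),v(\bar\epsilon)$ are its Lagrange multipliers). **Theorem.** Suppose that primal and dual nondegeneracy hold at $\bar\epsilon$. Then $\mathcal P^*(\bar\epsilon)$ and $\mathcal D^*(\bar\epsilon)$ are singletons, a solution map $\chi$ exists for some $\rho>0$, and for each $\rho>0$ any two solution maps coincide on $(\bar\epsilon-\rho,\bar\epsilon+\rho)$. For every solution map $\chi$, consider the condition $$(\ast)\qquad \begin{aligned}(u^i_j)^{(k)}(\bar\epsilon)&=0 && \text{for all } i\in\bar{\mathcal T}_1,\ 1\le j\le n_i,\ k\ge1,\\ \big((u^i_1)^2-\|u^i_{2:n_i}\|^2\big)^{(k)}(\bar\epsilon)&=0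 && \text{for all } i\in\bar{\mathcal T}_2,\ k\ge1,\\ v_i^{(k)}(\bar\epsilon)&=0 && \text{for all } i\in\bar{\mathcal T}_3,\ k\ge1.\end{aligned}$$ 1. The optimal partition is constant on a neighborhood of $\bar\epsilon$ contained in $\operatorname{int}\mathcal E$ if and only if $(\ast)$ holds. 2. If $\bar\epsilon$ does not lie in an invariancy interval, then $\bar\epsilon$ belongs to a nonlinearity interval if and only if $(\ast)$ holds. -/

import Mathlib

open Set Filter Topology
open scoped Matrix

noncomputable section

/-- A block vector `(x^1; …; x^p)`; the `i`-th block has `n_i = d i + 1` coordinates, so that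
`x i 0` is `x^i_1` and `fun j => x i j.succ` is `x^i_{2:n_i}`. -/
abbrev BlockVec {p : ℕ} (d : Fin p → ℕ) : Type := ∀ i : Fin p, Fin (d i + 1) → ℝ

/-- The Euclidean norm of the tail `x_{2:n}`. -/
def tailNorm {k : ℕ} (x : Fin (k + 1) → ℝ) : ℝ := Real.sqrt (∑ j : Fin k, x j.succ ^ 2)

/-- The second-order cone. -/
def soc (k : ℕ) : Set (Fin (k + 1) → ℝ) := {x | tailNorm x ≤ x 0}

/-- The interior of the second-order cone. -/
def socInt (k : ℕ) : Set (Fin (k + 1) → ℝ) := {x | tailNorm x < x 0}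

/-- The diagonal matrix `R = diag(1, -1, …, -1)`. -/
def reflMat (k : ℕ) : Matrix (Fin (k + 1)) (Fin (k + 1)) ℝ :=
  Matrix.diagonal (Fin.cons 1 fun _ => -1)

/-- The arrow-shaped matrix `L(x)`: first row and first column equal to `x`, and `x_1` on the
diagonal. -/
def arrowMat {k : ℕ} (x : Fin (k + 1) → ℝ) : Matrix (Fin (k + 1)) (Fin (k + 1)) ℝ :=
  Matrix.of fun a b => if a = 0 then x b else if b = 0 then x a else if a = b then x 0 else 0

/-- The ray `ℝ₊ x`. -/
def nonnegRay {k : ℕ} (x : Fin (k + 1) → ℝ) : Set (Fin (k + 1) → ℝ) :=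
  {y | ∃ t : ℝ, 0 ≤ t ∧ y = t • x}

/-- The index sets `(B, N, R, (T₁, T₂, T₃))` of an optimal partition of `p` cones. -/
@[ext]
structure ConePartition (p : ℕ) where
  B : Finset (Fin p)
  N : Finset (Fin p)
  R : Finset (Fin p)
  T1 : Finset (Fin p)
  T2 : Finset (Fin p)
  T3 : Finset (Fin p)

namespace ConePartition

variable {p : ℕ}

/-- The indices `R ∪ N ∪ T₃` of the slack variables `z^i`. -/
abbrev slackIdx (P : ConePartition p) : Finset (Fin p) := P.R ∪ P.N ∪ P.T3

/-- The indices `R ∪ T₃` of the quadratic constraints and their multipliers `v_i`. -/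
abbrev quadIdx (P : ConePartition p) : Finset (Fin p) := P.R ∪ P.T3

theorem mem_slackIdx_of_mem_quadIdx {P : ConePartition p} {i : Fin p} (h : i ∈ P.quadIdx) :
    i ∈ P.slackIdx := by
  simp only [quadIdx, slackIdx, Finset.mem_union] at h ⊢
  tauto

theorem mem_quadIdx_of_mem_T3 {P : ConePartition p} {i : Fin p} (h : i ∈ P.T3) :
    i ∈ P.quadIdx := Finset.mem_union_right _ h

end ConePartition

/-- The slack variables `z = (z^i)`, `i ∈ R ∪ N ∪ T₃`. -/
abbrev SlackVec {p : ℕ} (d : Fin p → ℕ) (P : ConePartition p) : Type :=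
  ∀ i : {i // i ∈ P.slackIdx}, Fin (d i + 1) → ℝ

/-- The space of the quadruples `(w; z; u; v)` with `w ∈ ℝ^m`, `z^i` for `i ∈ R ∪ N ∪ T₃`, `u^i`
for every cone `i`, and `v_i` for `i ∈ R ∪ T₃`. -/
abbrev KKTVar (m : ℕ) {p : ℕ} (d : Fin p → ℕ) (P : ConePartition p) : Type :=
  (Fin m → ℝ) × SlackVec d P × BlockVec d × ({i // i ∈ P.quadIdx} → ℝ)

namespace KKTVar

variable {m p : ℕ} {d : Fin p → ℕ} {P : ConePartition p}

abbrev w (q : KKTVar m d P) : Fin m → ℝ := q.1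

abbrev z (q : KKTVar m d P) : SlackVec d P := q.2.1

abbrev u (q : KKTVar m d P) : BlockVec d := q.2.2.1

abbrev v (q : KKTVar m d P) : {i // i ∈ P.quadIdx} → ℝ := q.2.2.2

end KKTVar

/-- The data of a pair of parametric second-order conic problems
`min {(c + ε c̄)ᵀ x : A x = b, x ∈ K}` and `max {bᵀ y : Aᵀ y + s = c + ε c̄, s ∈ K}`, where `K` is
the product of `p` second-order cones of dimensions `d i + 1` and `A = (A^1, …, A^p)`. -/
structure ParamSOCO (m p : ℕ) (d : Fin p → ℕ) where
  A : ∀ i : Fin p, Matrix (Fin m) (Fin (d i + 1)) ℝ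
  b : Fin m → ℝ
  c : BlockVec d
  cbar : BlockVec d

namespace ParamSOCO

variable {m p : ℕ} {d : Fin p → ℕ} (S : ParamSOCO m p d)

/-- The perturbed objective vector, block `i`. -/
def cost (ε : ℝ) (i : Fin p) : Fin (d i + 1) → ℝ := S.c i + ε • S.cbar i

def primalFeasible : Set (BlockVec d) :=
  {x | ∑ i, S.A i *ᵥ x i = S.b ∧ ∀ i, x i ∈ soc (d i)}

def dualFeasible (ε : ℝ) : Set ((Fin m → ℝ) × BlockVec d) :=
  {q | (∀ i, (S.A i)ᵀ *ᵥ q.1 + q.2 i = S.cost ε i) ∧ ∀ i, q.2 i ∈ soc (d i)}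

def primalObj (ε : ℝ) (x : BlockVec d) : ℝ := ∑ i, S.cost ε i ⬝ᵥ x i

/-- The optimal value function, with values in the extended reals. -/
def optVal (ε : ℝ) : EReal := ⨅ x ∈ S.primalFeasible, ((S.primalObj ε x : ℝ) : EReal)

/-- The domain of the optimal value function. -/
def dom : Set ℝ := {ε | ⊥ < S.optVal ε}

/-- The primal optimal set. -/
def primalOpt (ε : ℝ) : Set (BlockVec d) :=
  {x | ((S.primalObj ε x : ℝ) : EReal) = S.optVal ε ∧ x ∈ S.primalFeasible}

/-- The dual optimal set: dual feasible points whose objective is the primal optimal value. -/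
def dualOpt (ε : ℝ) : Set ((Fin m → ℝ) × BlockVec d) :=
  {q | ((S.b ⬝ᵥ q.1 : ℝ) : EReal) = S.optVal ε ∧ q ∈ S.dualFeasible ε}

/-- The interior point condition at `ε = 0`. -/
def InteriorPointCondition : Prop :=
  (∃ x ∈ S.primalFeasible, ∀ i, x i ∈ socInt (d i)) ∧
    ∃ q ∈ S.dualFeasible 0, ∀ i, q.2 i ∈ socInt (d i)

/-- Maximally complementary solutions: points of the relative interiors of the optimal sets. -/
def IsMaxCompl (ε : ℝ) (x : BlockVec d) (y : Fin m → ℝ) (s : BlockVec d) : Prop :=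
  x ∈ intrinsicInterior ℝ (S.primalOpt ε) ∧ (y, s) ∈ intrinsicInterior ℝ (S.dualOpt ε)

open Classical in
/-- The optimal partition at `ε`. -/
def partition (ε : ℝ) : ConePartition p where
  B := Finset.univ.filter fun i => ∃ x ∈ S.primalOpt ε, tailNorm (x i) < x i 0
  N := Finset.univ.filter fun i => ∃ q ∈ S.dualOpt ε, tailNorm (q.2 i) < q.2 i 0
  R := Finset.univ.filter fun i => ∃ x ∈ S.primalOpt ε, ∃ q ∈ S.dualOpt ε,
    (x i 0 = tailNorm (x i) ∧ 0 < tailNorm (x i)) ∧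
      (q.2 i 0 = tailNorm (q.2 i) ∧ 0 < tailNorm (q.2 i))
  T1 := Finset.univ.filter fun i => ∀ x ∈ S.primalOpt ε, ∀ q ∈ S.dualOpt ε, x i = 0 ∧ q.2 i = 0
  T2 := Finset.univ.filter fun i => (∀ q ∈ S.dualOpt ε, q.2 i = 0) ∧
    ∃ x ∈ S.primalOpt ε, x i 0 = tailNorm (x i) ∧ 0 < tailNorm (x i)
  T3 := Finset.univ.filter fun i => (∀ x ∈ S.primalOpt ε, x i = 0) ∧
    ∃ q ∈ S.dualOpt ε, q.2 i 0 = tailNorm (q.2 i) ∧ 0 < tailNorm (q.2 i)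

/-- The matrix `((A^i P^i)_{R ∪ T₂}, (A^i)_B)`. -/
def primalNondegMat (ε : ℝ) (P : ∀ i : Fin p, Matrix (Fin (d i + 1)) (Fin (d i)) ℝ) :
    Matrix (Fin m)
      ((Σ i : {i // i ∈ (S.partition ε).R ∪ (S.partition ε).T2}, Fin (d i)) ⊕
        (Σ i : {i // i ∈ (S.partition ε).B}, Fin (d i + 1))) ℝ :=
  Matrix.of fun r => Sum.elim (fun a => (S.A a.1 * P a.1) r a.2) (fun a => S.A a.1 r a.2)

/-- Primal nondegeneracy of `x`: the matrix `((A^i P^i)_{R ∪ T₂}, (A^i)_B)` has full row rank, where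
the `n_i - 1` columns of `P^i` are orthonormal eigenvectors for the positive eigenvalues of
`L(x^i)`. -/
def IsPrimalNondeg (ε : ℝ) (x : BlockVec d) : Prop :=
  ∃ P : ∀ i : Fin p, Matrix (Fin (d i + 1)) (Fin (d i)) ℝ,
    (∀ i ∈ (S.partition ε).R ∪ (S.partition ε).T2,
      (P i)ᵀ * P i = 1 ∧
        ∀ k, ∃ μ : ℝ, 0 < μ ∧ arrowMat (x i) *ᵥ (P i).col k = μ • (P i).col k) ∧
    LinearIndependent ℝ (S.primalNondegMat ε P).row

/-- The matrix `((A^i R^i s^i)_{R ∪ T₃}, (A^i)_{B ∪ T₁ ∪ T₂})`. -/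
def dualNondegMat (ε : ℝ) (s : BlockVec d) :
    Matrix (Fin m)
      ({i // i ∈ (S.partition ε).R ∪ (S.partition ε).T3} ⊕
        (Σ i : {i // i ∈ (S.partition ε).B ∪ (S.partition ε).T1 ∪ (S.partition ε).T2},
          Fin (d i + 1))) ℝ :=
  Matrix.of fun r =>
    Sum.elim (fun i => (S.A i *ᵥ (reflMat (d i) *ᵥ s i)) r) (fun a => S.A a.1 r a.2)

/-- Dual nondegeneracy of `(y, s)`: the matrix `((A^i R^i s^i)_{R ∪ T₃}, (A^i)_{B ∪ T₁ ∪ T₂})` has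
full column rank. -/
def IsDualNondeg (ε : ℝ) (s : BlockVec d) : Prop :=
  LinearIndependent ℝ (S.dualNondegMat ε s).col

/-- Both nondegeneracy conditions hold at `ε`: there is a maximally complementary solution that is
primal and dual nondegenerate. -/
def NondegenerateAt (ε : ℝ) : Prop :=
  ∃ x y s, S.IsMaxCompl ε x y s ∧ S.IsPrimalNondeg ε x ∧ S.IsDualNondeg ε s

/-- The optimal partition is the same at all points of `J`. -/
def PartitionConstOn (J : Set ℝ) : Prop :=
  ∀ ε₁ ∈ J, ∀ ε₂ ∈ J, S.partition ε₁ = S.partition ε₂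

/-- The extreme rays `ℝ₊ x^{*i}(ε)`, `i ∈ R ∪ T₂`, and `ℝ₊ s^{*i}(ε)`, `i ∈ R ∪ T₃`, do not vary
with `ε ∈ J`. -/
def RaysConstOn (J : Set ℝ) : Prop :=
  ∀ ε₁ ∈ J, ∀ ε₂ ∈ J, ∀ x₁ y₁ s₁ x₂ y₂ s₂,
    S.IsMaxCompl ε₁ x₁ y₁ s₁ → S.IsMaxCompl ε₂ x₂ y₂ s₂ →
      (∀ i ∈ (S.partition ε₁).R ∪ (S.partition ε₁).T2, nonnegRay (x₁ i) = nonnegRay (x₂ i)) ∧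
      (∀ i ∈ (S.partition ε₁).R ∪ (S.partition ε₁).T3, nonnegRay (s₁ i) = nonnegRay (s₂ i))

/-- An invariancy interval: a nonempty open subinterval of `int(dom)` on which the optimal
partition and the extreme rays are invariant. -/
def IsInvariancyInterval (J : Set ℝ) : Prop :=
  J.Nonempty ∧ IsOpen J ∧ J.OrdConnected ∧ J ⊆ interior S.dom ∧
    S.PartitionConstOn J ∧ S.RaysConstOn J

/-- A nonlinearity interval: a maximal nonempty open subinterval of `int(dom)` with a constant
optimal partition, on which some extreme ray varies. -/
def IsNonlinearityInterval (J : Set ℝ) : Prop :=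
  J.Nonempty ∧ IsOpen J ∧ J.OrdConnected ∧ J ⊆ interior S.dom ∧
    S.PartitionConstOn J ∧ ¬ S.RaysConstOn J ∧
    ∀ J' : Set ℝ, IsOpen J' → J'.OrdConnected → J' ⊆ interior S.dom → S.PartitionConstOn J' →
      J ⊆ J' → J' = J

/-- The optimal partition is constant near `ε₀`. -/
def PartitionConstNear (ε₀ : ℝ) : Prop :=
  ∃ δ : ℝ, 0 < δ ∧ Ioo (ε₀ - δ) (ε₀ + δ) ⊆ interior S.dom ∧
    ∀ ε ∈ Ioo (ε₀ - δ) (ε₀ + δ), S.partition ε = S.partition ε₀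

/-- The feasible set of the nonlinear reformulation `(DN_ε)` of the dual problem, written for the
index sets `P`. -/
def dnFeasible (P : ConePartition p) (ε : ℝ) : Set ((Fin m → ℝ) × SlackVec d P) :=
  {q | (∀ i ∈ P.B ∪ P.T1 ∪ P.T2, (S.A i)ᵀ *ᵥ q.1 = S.cost ε i) ∧
    (∀ i : {i // i ∈ P.slackIdx}, (S.A i)ᵀ *ᵥ q.1 + q.2 i = S.cost ε i) ∧
    (∀ i : {i // i ∈ P.slackIdx}, i.1 ∈ P.quadIdx →
      q.2 i ⬝ᵥ (reflMat (d i) *ᵥ q.2 i) = 0 ∧ 0 < q.2 i 0) ∧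
    (∀ i : {i // i ∈ P.slackIdx}, i.1 ∈ P.N → q.2 i ∈ socInt (d i))}

/-- `(w, z)` is a globally optimal solution of `(DN_ε) : min {-bᵀ w}`. -/
def IsDNGlobalOpt (P : ConePartition p) (ε : ℝ) (w : Fin m → ℝ) (z : SlackVec d P) : Prop :=
  (w, z) ∈ S.dnFeasible P ε ∧ ∀ q ∈ S.dnFeasible P ε, -(S.b ⬝ᵥ w) ≤ -(S.b ⬝ᵥ q.1)

/-- The mapping `G((w; z; u; v), ε)` of the first-order optimality conditions of `(DN_ε)`. Its four
groups of components are `-∑ A^i u^i - b`; then `-u^i - 2 v_i R^i z^i` for `i ∈ R ∪ T₃` and `-u^i`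
for `i ∈ N`; then `(A^i)ᵀ w + z^i - c^i - ε c̄^i` for `i ∈ R ∪ N ∪ T₃` and
`(A^i)ᵀ w - c^i - ε c̄^i` for the remaining `i`, that is `i ∈ B ∪ T₁ ∪ T₂`; and
`(z^i)ᵀ R^i z^i` for `i ∈ R ∪ T₃`. -/
def kktMap (P : ConePartition p) (q : KKTVar m d P) (ε : ℝ) : KKTVar m d P :=
  (-(∑ i, S.A i *ᵥ q.u i) - S.b,
   (fun i => if h : i.1 ∈ P.quadIdx
      then -q.u i - (2 * q.v ⟨i.1, h⟩) • (reflMat (d i) *ᵥ q.z i)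
      else -q.u i),
   (fun i => if h : i ∈ P.slackIdx
      then (S.A i)ᵀ *ᵥ q.w + q.z ⟨i, h⟩ - S.cost ε i
      else (S.A i)ᵀ *ᵥ q.w - S.cost ε i),
   (fun i => q.z ⟨i.1, ConePartition.mem_slackIdx_of_mem_quadIdx i.2⟩ ⬝ᵥ
      (reflMat (d i) *ᵥ q.z ⟨i.1, ConePartition.mem_slackIdx_of_mem_quadIdx i.2⟩)))

/-- `χ` is a real analytic solution map of `G = 0` on `(ε₀ - ρ, ε₀ + ρ)`, for the index sets of the
optimal partition at `ε₀`, whose value at `ε₀` consists of a globally optimal solution of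
`(DN_{ε₀})` and its Lagrange multipliers. -/
def IsSolutionMap (ε₀ ρ : ℝ) (χ : ℝ → KKTVar m d (S.partition ε₀)) : Prop :=
  0 < ρ ∧ AnalyticOnNhd ℝ χ (Ioo (ε₀ - ρ) (ε₀ + ρ)) ∧
    (∀ ε ∈ Ioo (ε₀ - ρ) (ε₀ + ρ), S.kktMap (S.partition ε₀) (χ ε) ε = 0) ∧
    S.IsDNGlobalOpt (S.partition ε₀) ε₀ (χ ε₀).w (χ ε₀).z

/-- All derivatives of order `k ≥ 1` vanish at `ε₀` for the functions `u^i_j` (`i ∈ T₁`),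
`(u^i_1)² - ‖u^i_{2:n_i}‖²` (`i ∈ T₂`) and `v_i` (`i ∈ T₃`). -/
def DerivativesVanish (ε₀ : ℝ) (χ : ℝ → KKTVar m d (S.partition ε₀)) : Prop :=
  (∀ i ∈ (S.partition ε₀).T1, ∀ j, ∀ k : ℕ, 1 ≤ k →
    iteratedDeriv k (fun ε => (χ ε).u i j) ε₀ = 0) ∧
  (∀ i ∈ (S.partition ε₀).T2, ∀ k : ℕ, 1 ≤ k →
    iteratedDeriv k (fun ε => (χ ε).u i 0 ^ 2 - tailNorm ((χ ε).u i) ^ 2) ε₀ = 0) ∧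
  (∀ (i : Fin p) (h : i ∈ (S.partition ε₀).T3), ∀ k : ℕ, 1 ≤ k →
    iteratedDeriv k (fun ε => (χ ε).v ⟨i, ConePartition.mem_quadIdx_of_mem_T3 h⟩) ε₀ = 0)

end ParamSOCO

end

/-!
Primal and dual nondegeneracy make the Jacobian of the first-order system nonsingular at the
optimal solution for `ε₀`, so the implicit function theorem gives a unique analytic branch of
KKT points through it. Near `ε₀`, the blocks in `B`, `N` and `R` of a point on the branch keep
their position relative to the cones by continuity, so the branch is optimal with the partition of
`ε₀` exactly when the primal blocks in `T₁` vanish, those in `T₂` stay on the boundary of the cone,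
and the dual blocks in `T₃` stay on the boundary, that is, when the quantities of condition `(∗)`
keep their value at `ε₀`; for analytic functions this means that all derivatives vanish. Conversely,
nondegeneracy forces the optimal solutions at nearby parameters to converge to the one at `ε₀`, so
those with the same partition lie on the branch.
-/

section Proportional

variable {ι 𝕜 : Type*} [Field 𝕜]

/-- The vector `a` is proportional to `b`. For `b ≠ 0` this says that `a` is a multiple of `b`; it
is encoded by the vanishing of the `2 × 2` minors because the resulting relation is closed. -/
def Proportional (a b : ι → 𝕜) : Prop := ∀ j l, a j * b l = a l * b j

theorem proportional_smul_self (t : 𝕜) (b : ι → 𝕜) : Proportional (t • b) b := by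
  intro j l
  simp only [Pi.smul_apply, smul_eq_mul]
  ring

theorem Proportional.smul {a b : ι → 𝕜} (h : Proportional a b) (t : 𝕜) :
    Proportional (t • a) b := by
  intro j l
  simp only [Pi.smul_apply, smul_eq_mul, mul_assoc, h j l]

theorem Proportional.exists_eq_smul {a b : ι → 𝕜} (h : Proportional a b) (hb : b ≠ 0) :
    ∃ t : 𝕜, a = t • b := by
  obtain ⟨l, hl⟩ := Function.ne_iff.1 hb
  rw [Pi.zero_apply] at hl
  refine ⟨a l / b l, funext fun j => ?_⟩
  rw [Pi.smul_apply, smul_eq_mul, div_mul_eq_mul_div, eq_div_iff hl, h j l]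

theorem isClosed_setOf_proportional [TopologicalSpace 𝕜] [IsTopologicalRing 𝕜] [T2Space 𝕜]
    {X : Type*} [TopologicalSpace X] {f g : X → ι → 𝕜} (hf : Continuous f) (hg : Continuous g) :
    IsClosed {q | Proportional (f q) (g q)} := by
  simp only [Proportional, ofPred_forall]
  exact isClosed_iInter fun _ => isClosed_iInter fun _ =>
    isClosed_eq (by fun_prop) (by fun_prop)

end Proportional

section Cone

variable {k : ℕ}

theorem tailNorm_eq_norm (a : Fin (k + 1) → ℝ) : tailNorm a = ‖WithLp.toLp 2 (Fin.tail a)‖ := by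
  simp [tailNorm, EuclideanSpace.norm_eq, Fin.tail]

theorem tailNorm_nonneg (a : Fin (k + 1) → ℝ) : 0 ≤ tailNorm a := Real.sqrt_nonneg _

theorem tailNorm_sq (a : Fin (k + 1) → ℝ) : tailNorm a ^ 2 = Fin.tail a ⬝ᵥ Fin.tail a := by
  rw [tailNorm, Real.sq_sqrt (Finset.sum_nonneg fun _ _ => sq_nonneg _), dotProduct]
  exact Finset.sum_congr rfl fun _ _ => pow_two _

theorem continuous_tailNorm : Continuous (tailNorm : (Fin (k + 1) → ℝ) → ℝ) := by
  unfold tailNorm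
  fun_prop

@[simp] theorem tailNorm_zero : tailNorm (0 : Fin (k + 1) → ℝ) = 0 := by
  simp [tailNorm]

theorem tailNorm_add_le (a b : Fin (k + 1) → ℝ) :
    tailNorm (a + b) ≤ tailNorm a + tailNorm b := by
  simp only [tailNorm_eq_norm]
  exact norm_add_le (WithLp.toLp 2 (Fin.tail a)) (WithLp.toLp 2 (Fin.tail b))

theorem tailNorm_smul (t : ℝ) (a : Fin (k + 1) → ℝ) : tailNorm (t • a) = |t| * tailNorm a := by
  simp only [tailNorm_eq_norm]
  exact norm_smul t (WithLp.toLp 2 (Fin.tail a))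

theorem abs_tail_dotProduct_le (a b : Fin (k + 1) → ℝ) :
    |Fin.tail a ⬝ᵥ Fin.tail b| ≤ tailNorm a * tailNorm b := by
  rw [tailNorm_eq_norm, tailNorm_eq_norm, mul_comm]
  simpa only [EuclideanSpace.inner_toLp_toLp, star_trivial] using
    abs_real_inner_le_norm (WithLp.toLp 2 (Fin.tail b)) (WithLp.toLp 2 (Fin.tail a))

theorem dotProduct_eq_head_add_tail (a b : Fin (k + 1) → ℝ) :
    a ⬝ᵥ b = a 0 * b 0 + Fin.tail a ⬝ᵥ Fin.tail b :=
  Fin.sum_univ_succ _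

theorem zero_mem_soc : (0 : Fin (k + 1) → ℝ) ∈ soc k := by
  simp [soc]

theorem isClosed_soc : IsClosed (soc k) :=
  isClosed_le continuous_tailNorm (continuous_apply 0)

theorem isOpen_socInt : IsOpen (socInt k) :=
  isOpen_lt continuous_tailNorm (continuous_apply 0)

theorem convex_soc : Convex ℝ (soc k) := by
  intro a ha b hb r t hr ht _
  refine (tailNorm_add_le _ _).trans ?_
  rw [tailNorm_smul, tailNorm_smul, abs_of_nonneg hr, abs_of_nonneg ht]
  exact add_le_add (mul_le_mul_of_nonneg_left ha hr) (mul_le_mul_of_nonneg_left hb ht)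

theorem eq_zero_of_mem_soc {a : Fin (k + 1) → ℝ} (h : a ∈ soc k) (h0 : a 0 ≤ 0) : a = 0 := by
  have htail : tailNorm a = 0 := le_antisymm (h.trans h0) (tailNorm_nonneg a)
  rw [tailNorm_eq_norm, norm_eq_zero, WithLp.toLp_eq_zero] at htail
  have hhead : a 0 = 0 := le_antisymm h0 ((tailNorm_nonneg a).trans h)
  exact funext (Fin.cases hhead (congrFun htail))

theorem dotProduct_nonneg_of_mem_soc {a b : Fin (k + 1) → ℝ} (ha : a ∈ soc k) (hb : b ∈ soc k) :
    0 ≤ a ⬝ᵥ b := by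
  have h := (abs_le.1 (abs_tail_dotProduct_le a b)).1
  have h1 := mul_le_mul (show tailNorm a ≤ a 0 from ha) (show tailNorm b ≤ b 0 from hb)
    (tailNorm_nonneg b) ((tailNorm_nonneg a).trans ha)
  rw [dotProduct_eq_head_add_tail]
  linarith

theorem eq_zero_of_dotProduct_eq_zero_of_mem_socInt {a b : Fin (k + 1) → ℝ} (ha : a ∈ socInt k)
    (hb : b ∈ soc k) (h0 : a ⬝ᵥ b = 0) : b = 0 := by
  have ha' : tailNorm a < a 0 := ha
  have h := (abs_le.1 (abs_tail_dotProduct_le a b)).1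
  have h1 := mul_le_mul_of_nonneg_left (show tailNorm b ≤ b 0 from hb) (tailNorm_nonneg a)
  rw [dotProduct_eq_head_add_tail] at h0
  apply eq_zero_of_mem_soc hb
  by_contra! hpos
  have := mul_pos (sub_pos.2 ha') hpos
  linarith

/-- The nonzero boundary points of the second-order cone. -/
def SocBdry (a : Fin (k + 1) → ℝ) : Prop := a 0 = tailNorm a ∧ 0 < tailNorm a

namespace SocBdry

variable {a : Fin (k + 1) → ℝ}

theorem pos (h : SocBdry a) : 0 < a 0 := h.1 ▸ h.2

theorem ne_zero (h : SocBdry a) : a ≠ 0 := by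
  rintro rfl
  exact h.pos.ne' rfl

theorem mem_soc (h : SocBdry a) : a ∈ soc k := h.1.ge

theorem notMem_socInt (h : SocBdry a) : a ∉ socInt k := fun ha => ha.ne h.1.symm

end SocBdry

theorem mem_soc_iff {a : Fin (k + 1) → ℝ} :
    a ∈ soc k ↔ a ∈ socInt k ∨ SocBdry a ∨ a = 0 := by
  refine ⟨fun h => ?_, ?_⟩
  · rcases lt_or_eq_of_le (show tailNorm a ≤ a 0 from h) with h1 | h1
    · exact Or.inl h1
    rcases (tailNorm_nonneg a).lt_or_eq with h2 | h2
    · exact Or.inr (Or.inl ⟨h1.symm, h2⟩)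
    · exact Or.inr (Or.inr (eq_zero_of_mem_soc h (h1.symm.trans h2.symm).le))
  · rintro (h | h | rfl)
    exacts [le_of_lt (show tailNorm a < a 0 from h), h.mem_soc, zero_mem_soc]

@[simp] theorem reflMat_mulVec_zero (a : Fin (k + 1) → ℝ) : (reflMat k *ᵥ a) 0 = a 0 := by
  simp [reflMat, Matrix.mulVec_diagonal]

@[simp] theorem tail_reflMat_mulVec (a : Fin (k + 1) → ℝ) :
    Fin.tail (reflMat k *ᵥ a) = -Fin.tail a := by
  funext j
  simp [reflMat, Matrix.mulVec_diagonal, Fin.tail]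

theorem reflMat_mulVec_mulVec (a : Fin (k + 1) → ℝ) : reflMat k *ᵥ (reflMat k *ᵥ a) = a := by
  funext j
  refine Fin.cases ?_ (fun j => ?_) j <;> simp [reflMat, Matrix.mulVec_diagonal]

theorem reflMat_mulVec_ne_zero {a : Fin (k + 1) → ℝ} (h : a ≠ 0) : reflMat k *ᵥ a ≠ 0 := by
  intro h0
  apply h
  rw [← reflMat_mulVec_mulVec a, h0, Matrix.mulVec_zero]

theorem dotProduct_reflMat (a b : Fin (k + 1) → ℝ) :
    a ⬝ᵥ (reflMat k *ᵥ b) = a 0 * b 0 - Fin.tail a ⬝ᵥ Fin.tail b := by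
  rw [dotProduct_eq_head_add_tail, reflMat_mulVec_zero, tail_reflMat_mulVec, dotProduct_neg,
    sub_eq_add_neg]

theorem dotProduct_reflMat_comm (a b : Fin (k + 1) → ℝ) :
    a ⬝ᵥ (reflMat k *ᵥ b) = b ⬝ᵥ (reflMat k *ᵥ a) := by
  rw [dotProduct_reflMat, dotProduct_reflMat, mul_comm, dotProduct_comm]

theorem dotProduct_reflMat_self (a : Fin (k + 1) → ℝ) :
    a ⬝ᵥ (reflMat k *ᵥ a) = a 0 ^ 2 - tailNorm a ^ 2 := by
  rw [dotProduct_reflMat, tailNorm_sq, pow_two]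

theorem socBdry_iff {a : Fin (k + 1) → ℝ} :
    SocBdry a ↔ a ⬝ᵥ (reflMat k *ᵥ a) = 0 ∧ 0 < a 0 := by
  rw [dotProduct_reflMat_self, sub_eq_zero]
  refine ⟨fun h => ⟨by rw [h.1], h.pos⟩, fun ⟨h, h0⟩ => ?_⟩
  rw [sq_eq_sq₀ h0.le (tailNorm_nonneg a)] at h
  exact ⟨h, h ▸ h0⟩

theorem SocBdry.reflMat_mulVec {a : Fin (k + 1) → ℝ} (h : SocBdry a) :
    SocBdry (reflMat k *ᵥ a) := by
  rw [socBdry_iff] at h ⊢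
  rwa [reflMat_mulVec_mulVec, dotProduct_comm, reflMat_mulVec_zero]

theorem dotProduct_reflMat_self_eq_neg_sq {b z : Fin (k + 1) → ℝ} (hb : SocBdry b)
    (h : b ⬝ᵥ (reflMat k *ᵥ z) = 0) :
    z ⬝ᵥ (reflMat k *ᵥ z) = -tailNorm (z - (z 0 / b 0) • b) ^ 2 := by
  have hhead : (z - (z 0 / b 0) • b) 0 = 0 := by simp [hb.pos.ne']
  have hz := dotProduct_reflMat_self (z - (z 0 / b 0) • b)
  rw [hhead] at hz
  simp only [sub_dotProduct, smul_dotProduct, Matrix.mulVec_sub, Matrix.mulVec_smul,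
    dotProduct_sub, dotProduct_smul, dotProduct_reflMat_comm z b, h, (socBdry_iff.1 hb).1,
    smul_eq_mul] at hz
  linarith

theorem dotProduct_reflMat_self_nonpos {b z : Fin (k + 1) → ℝ} (hb : SocBdry b)
    (h : b ⬝ᵥ (reflMat k *ᵥ z) = 0) : z ⬝ᵥ (reflMat k *ᵥ z) ≤ 0 := by
  rw [dotProduct_reflMat_self_eq_neg_sq hb h]
  exact neg_nonpos.2 (sq_nonneg _)

theorem eq_smul_of_dotProduct_reflMat_self_nonneg {b z : Fin (k + 1) → ℝ} (hb : SocBdry b)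
    (h : b ⬝ᵥ (reflMat k *ᵥ z) = 0) (hz : 0 ≤ z ⬝ᵥ (reflMat k *ᵥ z)) : z = (z 0 / b 0) • b := by
  rw [dotProduct_reflMat_self_eq_neg_sq hb h] at hz
  have htail : tailNorm (z - (z 0 / b 0) • b) = 0 :=
    pow_eq_zero_iff two_ne_zero |>.1 (le_antisymm (neg_nonneg.1 hz) (sq_nonneg _))
  have hhead : (z - (z 0 / b 0) • b) 0 = 0 := by simp [hb.pos.ne']
  exact sub_eq_zero.1 (eq_zero_of_mem_soc (htail.trans hhead.symm).le hhead.le)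

theorem eq_smul_reflMat_of_dotProduct_eq_zero {a b : Fin (k + 1) → ℝ} (ha : a ∈ soc k)
    (hb : SocBdry b) (h : a ⬝ᵥ b = 0) : a = (a 0 / b 0) • (reflMat k *ᵥ b) := by
  rw [← reflMat_mulVec_zero b]
  apply eq_smul_of_dotProduct_reflMat_self_nonneg hb.reflMat_mulVec
  · rwa [dotProduct_reflMat_comm, reflMat_mulVec_mulVec]
  · rw [dotProduct_reflMat_self, sub_nonneg]
    exact pow_le_pow_left₀ (tailNorm_nonneg a) ha 2

theorem exists_eq_smul_reflMat_of_dotProduct_eq_zero {a b : Fin (k + 1) → ℝ} (ha : a ∈ soc k)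
    (hb : b ∈ soc k) (hb0 : b ≠ 0) (h : a ⬝ᵥ b = 0) : ∃ t : ℝ, a = t • (reflMat k *ᵥ b) := by
  rcases mem_soc_iff.1 hb with hint | hbdry | hzero
  · rw [dotProduct_comm] at h
    exact ⟨0, by rw [zero_smul, eq_zero_of_dotProduct_eq_zero_of_mem_socInt hint ha h]⟩
  · exact ⟨_, eq_smul_reflMat_of_dotProduct_eq_zero ha hbdry h⟩
  · exact absurd hzero hb0

theorem proportional_sub_of_dotProduct_eq_zero {a a' b : Fin (k + 1) → ℝ} (ha : a ∈ soc k)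
    (ha' : a' ∈ soc k) (hb : b ∈ soc k) (hb0 : b ≠ 0) (h : a ⬝ᵥ b = 0) (h' : a' ⬝ᵥ b = 0) :
    Proportional (a' - a) (reflMat k *ᵥ b) := by
  obtain ⟨t, ht⟩ := exists_eq_smul_reflMat_of_dotProduct_eq_zero ha hb hb0 h
  obtain ⟨t', ht'⟩ := exists_eq_smul_reflMat_of_dotProduct_eq_zero ha' hb hb0 h'
  rw [ht, ht', ← sub_smul]
  exact proportional_smul_self _ _

theorem arrowMat_mulVec_zero (a v : Fin (k + 1) → ℝ) : (arrowMat a *ᵥ v) 0 = a ⬝ᵥ v := by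
  simp [arrowMat, Matrix.mulVec, dotProduct]

theorem tail_arrowMat_mulVec (a v : Fin (k + 1) → ℝ) :
    Fin.tail (arrowMat a *ᵥ v) = v 0 • Fin.tail a + a 0 • Fin.tail v := by
  funext j
  simp [arrowMat, Matrix.mulVec, Fin.tail, dotProduct, Fin.sum_univ_succ, mul_comm]

theorem arrowMat_mulVec_dotProduct_reflMat (a v : Fin (k + 1) → ℝ) :
    (arrowMat a *ᵥ v) ⬝ᵥ (reflMat k *ᵥ a) = v 0 * (a ⬝ᵥ (reflMat k *ᵥ a)) := by
  rw [dotProduct_reflMat, dotProduct_reflMat, arrowMat_mulVec_zero, tail_arrowMat_mulVec,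
    dotProduct_eq_head_add_tail a v, add_dotProduct, smul_dotProduct, smul_dotProduct,
    dotProduct_comm (Fin.tail v), smul_eq_mul, smul_eq_mul]
  ring

theorem dotProduct_reflMat_eq_zero_of_arrowMat_mulVec_eq_smul {a v : Fin (k + 1) → ℝ} {μ : ℝ}
    (ha : SocBdry a) (hμ : μ ≠ 0) (hv : arrowMat a *ᵥ v = μ • v) :
    v ⬝ᵥ (reflMat k *ᵥ a) = 0 := by
  have h := arrowMat_mulVec_dotProduct_reflMat a v
  rw [hv, (socBdry_iff.1 ha).1, mul_zero, smul_dotProduct, smul_eq_mul] at h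
  exact (mul_eq_zero.1 h).resolve_left hμ

end Cone

namespace ParamSOCO

variable {m p : ℕ} {d : Fin p → ℕ}

section Duality

variable {S : ParamSOCO m p d} {ε : ℝ} {x : BlockVec d} {y : Fin m → ℝ} {s : BlockVec d}

/-- Complementary solutions: primal and dual feasible points without duality gap, a notion which
does not mention the optimal value. -/
def IsComplSol (S : ParamSOCO m p d) (ε : ℝ) (x : BlockVec d) (y : Fin m → ℝ) (s : BlockVec d) :
    Prop :=
  x ∈ S.primalFeasible ∧ (y, s) ∈ S.dualFeasible ε ∧ ∑ i, x i ⬝ᵥ s i = 0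

theorem sum_dotProduct_transpose_mulVec (A : ∀ i, Matrix (Fin m) (Fin (d i + 1)) ℝ)
    (x : BlockVec d) (y : Fin m → ℝ) :
    ∑ i, x i ⬝ᵥ ((A i)ᵀ *ᵥ y) = (∑ i, A i *ᵥ x i) ⬝ᵥ y := by
  rw [sum_dotProduct]
  refine Finset.sum_congr rfl fun i _ => ?_
  rw [Matrix.mulVec_transpose, dotProduct_comm, ← Matrix.dotProduct_mulVec, dotProduct_comm]

theorem sum_dotProduct_eq_primalObj_sub (hx : ∑ i, S.A i *ᵥ x i = S.b)
    (hs : ∀ i, (S.A i)ᵀ *ᵥ y + s i = S.cost ε i) :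
    ∑ i, x i ⬝ᵥ s i = S.primalObj ε x - S.b ⬝ᵥ y := by
  rw [← hx, ← sum_dotProduct_transpose_mulVec, primalObj, ← Finset.sum_sub_distrib]
  refine Finset.sum_congr rfl fun i _ => ?_
  rw [← hs i, dotProduct_comm _ (x i), dotProduct_add, add_sub_cancel_left]

theorem dotProduct_le_primalObj (hx : x ∈ S.primalFeasible) (hq : (y, s) ∈ S.dualFeasible ε) :
    S.b ⬝ᵥ y ≤ S.primalObj ε x := by
  rw [← sub_nonneg, ← sum_dotProduct_eq_primalObj_sub hx.1 hq.1]
  exact Finset.sum_nonneg fun i _ => dotProduct_nonneg_of_mem_soc (hx.2 i) (hq.2 i)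

theorem dotProduct_le_optVal (hq : (y, s) ∈ S.dualFeasible ε) :
    ((S.b ⬝ᵥ y : ℝ) : EReal) ≤ S.optVal ε :=
  le_iInf₂ fun _ hx => EReal.coe_le_coe_iff.2 (dotProduct_le_primalObj hx hq)

theorem optVal_le_primalObj (hx : x ∈ S.primalFeasible) :
    S.optVal ε ≤ ((S.primalObj ε x : ℝ) : EReal) :=
  iInf₂_le x hx

namespace IsComplSol

theorem primalObj_eq (h : S.IsComplSol ε x y s) : S.primalObj ε x = S.b ⬝ᵥ y := by
  rw [← sub_eq_zero, ← sum_dotProduct_eq_primalObj_sub h.1.1 h.2.1.1, h.2.2]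

theorem mem_primalOpt (h : S.IsComplSol ε x y s) : x ∈ S.primalOpt ε := by
  refine ⟨le_antisymm ?_ (optVal_le_primalObj h.1), h.1⟩
  rw [h.primalObj_eq]
  exact dotProduct_le_optVal h.2.1

theorem mem_dualOpt (h : S.IsComplSol ε x y s) : (y, s) ∈ S.dualOpt ε := by
  refine ⟨?_, h.2.1⟩
  rw [← h.mem_primalOpt.1, h.primalObj_eq]

theorem mem_dom (h : S.IsComplSol ε x y s) : ε ∈ S.dom := by
  change ⊥ < S.optVal ε
  rw [← h.mem_primalOpt.1]
  exact EReal.bot_lt_coe _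

theorem dotProduct_eq_zero (h : S.IsComplSol ε x y s) (i : Fin p) : x i ⬝ᵥ s i = 0 :=
  (Finset.sum_eq_zero_iff_of_nonneg fun i _ =>
    dotProduct_nonneg_of_mem_soc (h.1.2 i) (h.2.1.2 i)).1 h.2.2 i (Finset.mem_univ i)

end IsComplSol

theorem isComplSol_of_mem_opt (hx : x ∈ S.primalOpt ε) (hq : (y, s) ∈ S.dualOpt ε) :
    S.IsComplSol ε x y s := by
  refine ⟨hx.2, hq.2, ?_⟩
  rw [sum_dotProduct_eq_primalObj_sub hx.2.1 hq.2.1,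
    EReal.coe_eq_coe_iff.1 (hx.1.trans hq.1.symm), sub_self]

theorem dotProduct_eq_zero_of_mem_opt (hx : x ∈ S.primalOpt ε) (hq : (y, s) ∈ S.dualOpt ε)
    (i : Fin p) : x i ⬝ᵥ s i = 0 := (isComplSol_of_mem_opt hx hq).dotProduct_eq_zero i

theorem primal_block_eq_zero {i : Fin p} (hN : ∃ q ∈ S.dualOpt ε, q.2 i ∈ socInt (d i))
    (hx : x ∈ S.primalOpt ε) : x i = 0 := by
  obtain ⟨q, hq, hi⟩ := hN
  apply eq_zero_of_dotProduct_eq_zero_of_mem_socInt hi (hx.2.2 i)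
  rw [dotProduct_comm, dotProduct_eq_zero_of_mem_opt hx hq]

theorem dual_block_eq_zero {i : Fin p} (hB : ∃ x ∈ S.primalOpt ε, x i ∈ socInt (d i))
    (hq : (y, s) ∈ S.dualOpt ε) : s i = 0 := by
  obtain ⟨x, hx, hi⟩ := hB
  exact eq_zero_of_dotProduct_eq_zero_of_mem_socInt hi (hq.2.2 i)
    (dotProduct_eq_zero_of_mem_opt hx hq i)

end Duality

section Pattern

variable {S : ParamSOCO m p d} {ε : ℝ} {x : BlockVec d} {y : Fin m → ℝ} {s : BlockVec d}

/-- The index sets `P` are read off from the positions of the blocks of the single pair `(x, s)`,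
which are those of the optimal partition when `x` and `s` are the only solutions. -/
structure HasPattern (P : ConePartition p) (x s : BlockVec d) : Prop where
  B : ∀ i, i ∈ P.B ↔ x i ∈ socInt (d i)
  N : ∀ i, i ∈ P.N ↔ s i ∈ socInt (d i)
  R : ∀ i, i ∈ P.R ↔ SocBdry (x i) ∧ SocBdry (s i)
  T1 : ∀ i, i ∈ P.T1 ↔ x i = 0 ∧ s i = 0
  T2 : ∀ i, i ∈ P.T2 ↔ s i = 0 ∧ SocBdry (x i)
  T3 : ∀ i, i ∈ P.T3 ↔ x i = 0 ∧ SocBdry (s i)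

theorem HasPattern.unique {P P' : ConePartition p} (h : HasPattern P x s)
    (h' : HasPattern P' x s) : P = P' := by
  apply ConePartition.ext <;> ext i
  exacts [(h.B i).trans (h'.B i).symm, (h.N i).trans (h'.N i).symm, (h.R i).trans (h'.R i).symm,
    (h.T1 i).trans (h'.T1 i).symm, (h.T2 i).trans (h'.T2 i).symm, (h.T3 i).trans (h'.T3 i).symm]

theorem HasPattern.socBdry_primal {P : ConePartition p} (h : HasPattern P x s) {i : Fin p}
    (hi : i ∈ P.R ∪ P.T2) : SocBdry (x i) :=
  (Finset.mem_union.1 hi).elim (fun hi => ((h.R i).1 hi).1) (fun hi => ((h.T2 i).1 hi).2)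

theorem HasPattern.socBdry_dual {P : ConePartition p} (h : HasPattern P x s) {i : Fin p}
    (hi : i ∈ P.R ∪ P.T3) : SocBdry (s i) :=
  (Finset.mem_union.1 hi).elim (fun hi => ((h.R i).1 hi).2) (fun hi => ((h.T3 i).1 hi).2)

theorem hasPattern_partition (hx : x ∈ S.primalOpt ε) (hq : (y, s) ∈ S.dualOpt ε)
    (ux : ∀ x' ∈ S.primalOpt ε, x' = x) (uq : ∀ q ∈ S.dualOpt ε, q = (y, s)) :
    HasPattern (S.partition ε) x s := by
  have hprimal : S.primalOpt ε = {x} := Set.eq_singleton_iff_unique_mem.2 ⟨hx, ux⟩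
  have hdual : S.dualOpt ε = {(y, s)} := Set.eq_singleton_iff_unique_mem.2 ⟨hq, uq⟩
  constructor <;> intro i <;> simp [partition, hprimal, hdual, SocBdry, socInt]

theorem mem_partition_B {i : Fin p} :
    i ∈ (S.partition ε).B ↔ ∃ x ∈ S.primalOpt ε, x i ∈ socInt (d i) := by
  simp [partition, socInt]

theorem mem_partition_N {i : Fin p} :
    i ∈ (S.partition ε).N ↔ ∃ q ∈ S.dualOpt ε, q.2 i ∈ socInt (d i) := by
  simp [partition, socInt]

theorem partition_cover (S : ParamSOCO m p d) (ε : ℝ) (i : Fin p) :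
    i ∈ (S.partition ε).N ∨ i ∈ (S.partition ε).R ∪ (S.partition ε).T3 ∨
      i ∈ (S.partition ε).B ∪ (S.partition ε).T1 ∪ (S.partition ε).T2 := by
  have hprimal : ∀ x ∈ S.primalOpt ε, x i ∈ socInt (d i) ∨ SocBdry (x i) ∨ x i = 0 :=
    fun x hx => mem_soc_iff.1 (hx.2.2 i)
  have hdual : ∀ q ∈ S.dualOpt ε, q.2 i ∈ socInt (d i) ∨ SocBdry (q.2 i) ∨ q.2 i = 0 :=
    fun q hq => mem_soc_iff.1 (hq.2.2 i)
  simp only [partition, Finset.mem_union, Finset.mem_filter, Finset.mem_univ, true_and]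
  by_cases hX : ∀ x ∈ S.primalOpt ε, x i = 0 <;> by_cases hS : ∀ q ∈ S.dualOpt ε, q.2 i = 0
  · exact Or.inr (Or.inr (Or.inl (Or.inr fun x hx q hq => ⟨hX x hx, hS q hq⟩)))
  · push Not at hS
    obtain ⟨q, hq, hq0⟩ := hS
    rcases hdual q hq with hint | hbdry | hzero
    exacts [Or.inl ⟨q, hq, hint⟩, Or.inr (Or.inl (Or.inr ⟨hX, q, hq, hbdry⟩)), absurd hzero hq0]
  · push Not at hX
    obtain ⟨x, hx, hx0⟩ := hX
    rcases hprimal x hx with hint | hbdry | hzero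
    exacts [Or.inr (Or.inr (Or.inl (Or.inl ⟨x, hx, hint⟩))),
      Or.inr (Or.inr (Or.inr ⟨hS, x, hx, hbdry⟩)), absurd hzero hx0]
  · push Not at hX hS
    obtain ⟨x, hx, hx0⟩ := hX
    obtain ⟨q, hq, hq0⟩ := hS
    rcases hprimal x hx with hint | hbdry | hzero
    · exact Or.inr (Or.inr (Or.inl (Or.inl ⟨x, hx, hint⟩)))
    · rcases hdual q hq with hint' | hbdry' | hzero'
      exacts [Or.inl ⟨q, hq, hint'⟩, Or.inr (Or.inl (Or.inl ⟨x, hx, q, hq, hbdry, hbdry'⟩)),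
        absurd hzero' hq0]
    · exact absurd hzero hx0

theorem dual_block_eq_zero_of_mem_partition (hx : x ∈ S.primalOpt ε) (hq : (y, s) ∈ S.dualOpt ε)
    {i : Fin p} (hi : i ∈ (S.partition ε).B ∪ (S.partition ε).T1 ∪ (S.partition ε).T2) :
    s i = 0 := by
  simp only [partition, Finset.mem_union, Finset.mem_filter, Finset.mem_univ, true_and] at hi
  rcases hi with (hB | hT1) | hT2
  exacts [dual_block_eq_zero hB hq, (hT1 x hx _ hq).2, hT2.1 _ hq]

end Pattern

section Nondegeneracy

variable {S : ParamSOCO m p d} {P : ConePartition p} {ε : ℝ} {x : BlockVec d} {y : Fin m → ℝ}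
  {s : BlockVec d}

/-- Primal nondegeneracy with respect to the index sets `P`, as the triviality of a kernel: `Aᵀ` is
injective modulo the normal directions of the face of `x`. -/
def PrimalKerTrivial (S : ParamSOCO m p d) (P : ConePartition p) (x : BlockVec d) : Prop :=
  ∀ h : Fin m → ℝ, (∀ i ∈ P.B, (S.A i)ᵀ *ᵥ h = 0) →
    (∀ i ∈ P.R ∪ P.T2, Proportional ((S.A i)ᵀ *ᵥ h) (reflMat (d i) *ᵥ x i)) → h = 0

/-- Dual nondegeneracy with respect to the index sets `P`, as the triviality of a kernel: `A` is
injective on the block vectors complementary to the face of `s`. -/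
def DualKerTrivial (S : ParamSOCO m p d) (P : ConePartition p) (s : BlockVec d) : Prop :=
  ∀ h : BlockVec d, ∑ i, S.A i *ᵥ h i = 0 → (∀ i ∈ P.N, h i = 0) →
    (∀ i ∈ P.R ∪ P.T3, Proportional (h i) (reflMat (d i) *ᵥ s i)) → h = 0

theorem primalOpt_unique (hD : S.DualKerTrivial P s) (hq : (y, s) ∈ S.dualOpt ε)
    (hN : ∀ i ∈ P.N, ∃ q ∈ S.dualOpt ε, q.2 i ∈ socInt (d i))
    (hs : ∀ i ∈ P.R ∪ P.T3, s i ≠ 0) (hx : x ∈ S.primalOpt ε) {x' : BlockVec d}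
    (hx' : x' ∈ S.primalOpt ε) : x' = x := by
  apply sub_eq_zero.1
  apply hD
  · simp only [Pi.sub_apply, Matrix.mulVec_sub, Finset.sum_sub_distrib]
    rw [hx'.2.1, hx.2.1, sub_self]
  · intro i hi
    rw [Pi.sub_apply, primal_block_eq_zero (hN i hi) hx, primal_block_eq_zero (hN i hi) hx',
      sub_zero]
  · intro i hi
    exact proportional_sub_of_dotProduct_eq_zero (hx.2.2 i) (hx'.2.2 i) (hq.2.2 i) (hs i hi)
      (dotProduct_eq_zero_of_mem_opt hx hq i) (dotProduct_eq_zero_of_mem_opt hx' hq i)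

theorem dualOpt_unique (hP : S.PrimalKerTrivial P x) (hx : x ∈ S.primalOpt ε)
    (hB : ∀ i ∈ P.B, ∃ x ∈ S.primalOpt ε, x i ∈ socInt (d i))
    (hx0 : ∀ i ∈ P.R ∪ P.T2, x i ≠ 0) (hq : (y, s) ∈ S.dualOpt ε)
    {q : (Fin m → ℝ) × BlockVec d} (hq' : q ∈ S.dualOpt ε) : q = (y, s) := by
  obtain ⟨y', s'⟩ := q
  have hsub : ∀ i, (S.A i)ᵀ *ᵥ (y - y') = s' i - s i := fun i => by
    rw [Matrix.mulVec_sub, sub_eq_sub_iff_add_eq_add]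
    exact ((hq.2.1 i).trans (hq'.2.1 i).symm).trans (add_comm _ _)
  have hy : y - y' = 0 := by
    refine hP _ (fun i hi => ?_) fun i hi => ?_
    · rw [hsub, dual_block_eq_zero (hB i hi) hq, dual_block_eq_zero (hB i hi) hq', sub_zero]
    · have hcompl := fun {q} (hq : q ∈ S.dualOpt ε) =>
        (dotProduct_comm (q.2 i) (x i)).trans (dotProduct_eq_zero_of_mem_opt hx hq i)
      rw [hsub]
      exact proportional_sub_of_dotProduct_eq_zero (hq.2.2 i) (hq'.2.2 i) (hx.2.2 i) (hx0 i hi)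
        (hcompl hq) (hcompl hq')
  refine Prod.ext (sub_eq_zero.1 hy).symm (funext fun i => ?_)
  rw [← sub_eq_zero, ← hsub i, hy, Matrix.mulVec_zero]

theorem IsPrimalNondeg.primalKerTrivial (h : S.IsPrimalNondeg ε x)
    (hx : ∀ i ∈ (S.partition ε).R ∪ (S.partition ε).T2, SocBdry (x i)) :
    S.PrimalKerTrivial (S.partition ε) x := by
  obtain ⟨P, hP, hli⟩ := h
  intro h hB hR
  apply Matrix.vecMul_injective_iff.2 hli
  simp only [Matrix.zero_vecMul]
  funext c
  rcases c with ⟨⟨i, hi⟩, k⟩ | ⟨⟨i, hi⟩, k⟩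
  · obtain ⟨t, ht⟩ := (hR i hi).exists_eq_smul (reflMat_mulVec_ne_zero (hx i hi).ne_zero)
    obtain ⟨μ, hμ, hv⟩ := (hP i hi).2 k
    have hcol : (h ᵥ* (S.A i * P i)) k = 0 := by
      rw [← Matrix.vecMul_vecMul, ← Matrix.mulVec_transpose (S.A i), ht]
      change _ ⬝ᵥ (P i).col k = 0
      rw [dotProduct_comm, dotProduct_smul,
        dotProduct_reflMat_eq_zero_of_arrowMat_mulVec_eq_smul (hx i hi) hμ.ne' hv, smul_zero]
    exact hcol
  · have hcol : (h ᵥ* S.A i) k = 0 := by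
      rw [← Matrix.mulVec_transpose, hB i hi]
      rfl
    exact hcol

theorem dualNondegMat_mulVec
    (t : {i // i ∈ (S.partition ε).R ∪ (S.partition ε).T3} → ℝ) (g : BlockVec d) :
    S.dualNondegMat ε s *ᵥ Sum.elim t (fun a => g a.1 a.2) =
      ∑ i, t i • (S.A i *ᵥ (reflMat (d i) *ᵥ s i)) +
        ∑ i : {i // i ∈ (S.partition ε).B ∪ (S.partition ε).T1 ∪ (S.partition ε).T2},
          S.A i *ᵥ g i := by
  funext r
  simp only [Matrix.mulVec, dotProduct, dualNondegMat, Matrix.of_apply, Fintype.sum_sum_type,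
    Fintype.sum_sigma, Sum.elim_inl, Sum.elim_inr, Pi.add_apply, Finset.sum_apply, Pi.smul_apply,
    smul_eq_mul, mul_comm (t _)]

theorem IsDualNondeg.ne_zero (h : S.IsDualNondeg ε s) {i : Fin p}
    (hi : i ∈ (S.partition ε).R ∪ (S.partition ε).T3) : s i ≠ 0 := by
  intro h0
  apply LinearIndependent.ne_zero (Sum.inl ⟨i, hi⟩) h
  funext r
  simp [dualNondegMat, h0]

theorem IsDualNondeg.dualKerTrivial (h : S.IsDualNondeg ε s) (hx : x ∈ S.primalOpt ε)
    (hq : (y, s) ∈ S.dualOpt ε) : S.DualKerTrivial (S.partition ε) s := by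
  intro g hg hN hR
  choose t ht using fun i : {i // i ∈ (S.partition ε).R ∪ (S.partition ε).T3} =>
    (hR i i.2).exists_eq_smul (reflMat_mulVec_ne_zero (h.ne_zero i.2))
  have hmul : S.dualNondegMat ε s *ᵥ Sum.elim t (fun a => g a.1 a.2) = 0 := by
    have hdisj : Disjoint ((S.partition ε).R ∪ (S.partition ε).T3)
        ((S.partition ε).B ∪ (S.partition ε).T1 ∪ (S.partition ε).T2) :=
      Finset.disjoint_left.2 fun i hi hi' =>
        h.ne_zero hi (dual_block_eq_zero_of_mem_partition hx hq hi')
    simp only [dualNondegMat_mulVec, ← Matrix.mulVec_smul, ← ht]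
    rw [Finset.sum_coe_sort _ fun i => S.A i *ᵥ g i, Finset.sum_coe_sort _ fun i => S.A i *ᵥ g i,
      ← Finset.sum_union hdisj, ← hg]
    refine Finset.sum_subset (Finset.subset_univ _) fun i _ hi => ?_
    rw [Finset.mem_union] at hi
    rw [hN i ((S.partition_cover ε i).resolve_right hi), Matrix.mulVec_zero]
  have hzero := Matrix.mulVec_injective_iff.2 h (hmul.trans (Matrix.mulVec_zero _).symm)
  funext i
  rcases S.partition_cover ε i with hi | hi | hi
  · exact hN i hi
  · rw [ht ⟨i, hi⟩, show t ⟨i, hi⟩ = 0 from congrFun hzero (Sum.inl ⟨i, hi⟩), zero_smul]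
    rfl
  · exact funext fun j => congrFun hzero (Sum.inr ⟨⟨i, hi⟩, j⟩)

/-- A complementary solution whose block positions are described by `P` and which is primal and
dual nondegenerate with respect to `P`; such a solution is unique, and `P` is the optimal
partition. -/
structure IsNondegSol (S : ParamSOCO m p d) (P : ConePartition p) (ε : ℝ) (x : BlockVec d)
    (y : Fin m → ℝ) (s : BlockVec d) : Prop where
  isComplSol : S.IsComplSol ε x y s
  pattern : HasPattern P x s
  primalKerTrivial : S.PrimalKerTrivial P x
  dualKerTrivial : S.DualKerTrivial P s

namespace IsNondegSol

theorem primal_unique (h : S.IsNondegSol P ε x y s) : ∀ x' ∈ S.primalOpt ε, x' = x := fun _ =>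
  primalOpt_unique h.dualKerTrivial h.isComplSol.mem_dualOpt
    (fun i hi => ⟨_, h.isComplSol.mem_dualOpt, (h.pattern.N i).1 hi⟩)
    (fun _ hi => (h.pattern.socBdry_dual hi).ne_zero) h.isComplSol.mem_primalOpt

theorem dual_unique (h : S.IsNondegSol P ε x y s) : ∀ q ∈ S.dualOpt ε, q = (y, s) := fun _ =>
  dualOpt_unique h.primalKerTrivial h.isComplSol.mem_primalOpt
    (fun i hi => ⟨_, h.isComplSol.mem_primalOpt, (h.pattern.B i).1 hi⟩)
    (fun _ hi => (h.pattern.socBdry_primal hi).ne_zero) h.isComplSol.mem_dualOpt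

theorem partition_eq (h : S.IsNondegSol P ε x y s) : S.partition ε = P :=
  (hasPattern_partition h.isComplSol.mem_primalOpt h.isComplSol.mem_dualOpt h.primal_unique
    h.dual_unique).unique h.pattern

end IsNondegSol

theorem isNondegSol_partition (hx : x ∈ S.primalOpt ε) (hq : (y, s) ∈ S.dualOpt ε)
    (hx0 : ∀ i ∈ (S.partition ε).R ∪ (S.partition ε).T2, x i ≠ 0)
    (hs0 : ∀ i ∈ (S.partition ε).R ∪ (S.partition ε).T3, s i ≠ 0)
    (hP : S.PrimalKerTrivial (S.partition ε) x) (hD : S.DualKerTrivial (S.partition ε) s) :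
    S.IsNondegSol (S.partition ε) ε x y s where
  isComplSol := isComplSol_of_mem_opt hx hq
  pattern := hasPattern_partition hx hq
    (fun _ => primalOpt_unique hD hq (fun _ => mem_partition_N.1) hs0 hx)
    (fun _ => dualOpt_unique hP hx (fun _ => mem_partition_B.1) hx0 hq)
  primalKerTrivial := hP
  dualKerTrivial := hD

theorem NondegenerateAt.exists_isNondegSol (h : S.NondegenerateAt ε) :
    ∃ x y s, S.IsNondegSol (S.partition ε) ε x y s := by
  obtain ⟨x, y, s, ⟨hx, hq⟩, hpn, hdn⟩ := h
  replace hx := intrinsicInterior_subset hx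
  replace hq := intrinsicInterior_subset hq
  have hs0 := fun i (hi : i ∈ (S.partition ε).R ∪ (S.partition ε).T3) => hdn.ne_zero hi
  have hD := hdn.dualKerTrivial hx hq
  have hunique : ∀ x' ∈ S.primalOpt ε, x' = x := fun _ =>
    primalOpt_unique hD hq (fun _ => mem_partition_N.1) hs0 hx
  have hbdry : ∀ i ∈ (S.partition ε).R ∪ (S.partition ε).T2, SocBdry (x i) := by
    simp only [partition, Finset.mem_union, Finset.mem_filter, Finset.mem_univ, true_and]
    rintro i (⟨x', hx', _, _, hi, _⟩ | ⟨_, x', hx', hi⟩)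
    exacts [hunique x' hx' ▸ hi, hunique x' hx' ▸ hi]
  exact ⟨x, y, s, isNondegSol_partition hx hq (fun i hi => (hbdry i hi).ne_zero) hs0
    (hpn.primalKerTrivial hbdry) hD⟩

end Nondegeneracy

end ParamSOCO

section ClosedFamilies

variable {X E : Type*} [TopologicalSpace X]

theorem eventually_forall_notMem_of_isClosed [TopologicalSpace E] {C : Set (X × E)}
    (hC : IsClosed C) {K : Set E} (hK : IsCompact K) {x₀ : X} (h : ∀ q ∈ K, (x₀, q) ∉ C) :
    ∀ᶠ x in 𝓝 x₀, ∀ q ∈ K, (x, q) ∉ C :=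
  hK.eventually_forall_of_forall_eventually fun q hq => hC.isOpen_compl.mem_nhds (h q hq)

theorem eventually_forall_eq_zero_of_isClosed [NormedAddCommGroup E] [NormedSpace ℝ E]
    [ProperSpace E] {C : Set (X × E)} (hC : IsClosed C)
    (hsmul : ∀ x h (t : ℝ), (x, h) ∈ C → (x, t • h) ∈ C) {x₀ : X}
    (h₀ : ∀ h, (x₀, h) ∈ C → h = 0) : ∀ᶠ x in 𝓝 x₀, ∀ h, (x, h) ∈ C → h = 0 := by
  have hsphere : ∀ h ∈ Metric.sphere (0 : E) 1, (x₀, h) ∉ C := fun h hh hC =>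
    Metric.ne_of_mem_sphere hh one_ne_zero (h₀ h hC)
  filter_upwards [eventually_forall_notMem_of_isClosed hC (isCompact_sphere 0 1) hsphere]
    with x hx h hxh
  by_contra hne
  refine hx (‖h‖⁻¹ • h) ?_ (hsmul x h _ hxh)
  rw [mem_sphere_zero_iff_norm, norm_smul, norm_inv, norm_norm,
    inv_mul_cancel₀ (norm_ne_zero_iff.2 hne)]

end ClosedFamilies

namespace ParamSOCO

section Stability

variable {m p : ℕ} {d : Fin p → ℕ} {S : ParamSOCO m p d} {P : ConePartition p} {ε₀ ε : ℝ}
  {x x' : BlockVec d} {y y' : Fin m → ℝ} {s s' : BlockVec d}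

theorem PrimalKerTrivial.eventually (h : S.PrimalKerTrivial P x) :
    ∀ᶠ x' in 𝓝 x, S.PrimalKerTrivial P x' := by
  have hclosed : IsClosed {q : BlockVec d × (Fin m → ℝ) | (∀ i ∈ P.B, (S.A i)ᵀ *ᵥ q.2 = 0) ∧
      ∀ i ∈ P.R ∪ P.T2, Proportional ((S.A i)ᵀ *ᵥ q.2) (reflMat (d i) *ᵥ q.1 i)} := by
    simp only [ofPred_and, ofPred_forall]
    refine (isClosed_biInter fun i _ => ?_).inter (isClosed_biInter fun i _ => ?_)
    · exact isClosed_eq (continuous_const.matrix_mulVec continuous_snd) continuous_const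
    · exact isClosed_setOf_proportional (continuous_const.matrix_mulVec continuous_snd)
        (continuous_const.matrix_mulVec ((continuous_apply i).comp continuous_fst))
  have hker := eventually_forall_eq_zero_of_isClosed hclosed ?_ (x₀ := x)
    fun g hg => h g hg.1 hg.2
  · filter_upwards [hker] with x' hx' g hB hR using hx' g ⟨hB, hR⟩
  · rintro x' g t ⟨hB, hR⟩
    refine ⟨fun i hi => ?_, fun i hi => ?_⟩ <;> dsimp only <;> rw [Matrix.mulVec_smul]
    exacts [(congrArg (t • ·) (hB i hi)).trans (smul_zero t), (hR i hi).smul t]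

theorem DualKerTrivial.eventually (h : S.DualKerTrivial P s) :
    ∀ᶠ s' in 𝓝 s, S.DualKerTrivial P s' := by
  have hclosed : IsClosed {q : BlockVec d × BlockVec d | ∑ i, S.A i *ᵥ q.2 i = 0 ∧
      (∀ i ∈ P.N, q.2 i = 0) ∧
      ∀ i ∈ P.R ∪ P.T3, Proportional (q.2 i) (reflMat (d i) *ᵥ q.1 i)} := by
    simp only [ofPred_and, ofPred_forall]
    refine .inter ?_ ((isClosed_biInter fun i _ => ?_).inter (isClosed_biInter fun i _ => ?_))
    · exact isClosed_eq (continuous_finsetSum _ fun i _ =>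
        continuous_const.matrix_mulVec (by fun_prop)) continuous_const
    · exact isClosed_eq (by fun_prop) continuous_const
    · exact isClosed_setOf_proportional ((continuous_apply i).comp continuous_snd)
        (continuous_const.matrix_mulVec ((continuous_apply i).comp continuous_fst))
  have hker := eventually_forall_eq_zero_of_isClosed hclosed ?_ (x₀ := s)
    fun g hg => h g hg.1 hg.2.1 hg.2.2
  · filter_upwards [hker] with s' hs' g hsum hN hR using hs' g ⟨hsum, hN, hR⟩
  · rintro s' g t ⟨hsum, hN, hR⟩
    refine ⟨?_, fun i hi => ?_, fun i hi => (hR i hi).smul t⟩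
    · simp only [Pi.smul_apply, Matrix.mulVec_smul, ← Finset.smul_sum]
      rw [hsum, smul_zero]
    · exact (congrArg (t • ·) (hN i hi)).trans (smul_zero t)

theorem isClosed_primalFeasible : IsClosed S.primalFeasible := by
  simp only [primalFeasible, ofPred_and, ofPred_forall]
  refine .inter ?_ (isClosed_iInter fun i => isClosed_soc.preimage (continuous_apply i))
  exact isClosed_eq (continuous_finsetSum _ fun i _ =>
    continuous_const.matrix_mulVec (continuous_apply i)) continuous_const

theorem isClosed_setOf_mem_dualFeasible :
    IsClosed {e : ℝ × ((Fin m → ℝ) × BlockVec d) | e.2 ∈ S.dualFeasible e.1} := by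
  change IsClosed ({e : ℝ × ((Fin m → ℝ) × BlockVec d) |
    ∀ i, (S.A i)ᵀ *ᵥ e.2.1 + e.2.2 i = S.cost e.1 i} ∩ {e | ∀ i, e.2.2 i ∈ soc (d i)})
  have hslack : ∀ i, Continuous fun e : ℝ × ((Fin m → ℝ) × BlockVec d) => e.2.2 i :=
    fun i => by fun_prop
  rw [ofPred_forall, ofPred_forall]
  refine (isClosed_iInter fun i => isClosed_eq (.add ?_ (hslack i)) ?_).inter
    (isClosed_iInter fun i => isClosed_soc.preimage (hslack i))
  · exact continuous_const.matrix_mulVec (by fun_prop)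
  · unfold cost
    fun_prop

theorem convex_primalFeasible : Convex ℝ S.primalFeasible := by
  rintro x ⟨hx, hxK⟩ x' ⟨hx', hxK'⟩ a b ha hb hab
  refine ⟨?_, fun i => convex_soc (hxK i) (hxK' i) ha hb hab⟩
  simp only [Pi.add_apply, Pi.smul_apply, Matrix.mulVec_add, Matrix.mulVec_smul,
    Finset.sum_add_distrib, ← Finset.smul_sum]
  rw [hx, hx', ← add_smul, hab, one_smul]

theorem convex_setOf_mem_dualFeasible :
    Convex ℝ {e : ℝ × ((Fin m → ℝ) × BlockVec d) | e.2 ∈ S.dualFeasible e.1} := by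
  rintro ⟨ε, y, s⟩ ⟨h, hK⟩ ⟨ε', y', s'⟩ ⟨h', hK'⟩ a b ha hb hab
  refine ⟨fun i => ?_, fun i => convex_soc (hK i) (hK' i) ha hb hab⟩
  calc (S.A i)ᵀ *ᵥ (a • y + b • y') + (a • s i + b • s' i)
      = a • S.cost ε i + b • S.cost ε' i := by
        rw [← h i, ← h' i, Matrix.mulVec_add, Matrix.mulVec_smul, Matrix.mulVec_smul]
        module
    _ = (a + b) • S.c i + (a * ε + b * ε') • S.cbar i := by
        simp only [cost]
        module
    _ = S.cost (a * ε + b * ε') i := by rw [hab, one_smul, cost]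

theorem sum_sub_dotProduct_sub (hx : ∑ i, S.A i *ᵥ x i = S.b) (hx' : ∑ i, S.A i *ᵥ x' i = S.b)
    (hs : ∀ i, (S.A i)ᵀ *ᵥ y + s i = S.cost ε₀ i)
    (hs' : ∀ i, (S.A i)ᵀ *ᵥ y' + s' i = S.cost ε i) :
    ∑ i, (x' - x) i ⬝ᵥ (s' - s) i = (ε - ε₀) * ∑ i, (x' - x) i ⬝ᵥ S.cbar i := by
  have hcost : ∀ i, (s' - s) i = (ε - ε₀) • S.cbar i - (S.A i)ᵀ *ᵥ (y' - y) := fun i => by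
    rw [Matrix.mulVec_sub, Pi.sub_apply, eq_sub_of_add_eq' (hs i), eq_sub_of_add_eq' (hs' i),
      cost, cost]
    module
  simp only [hcost, dotProduct_sub, dotProduct_smul, Finset.sum_sub_distrib,
    sum_dotProduct_transpose_mulVec, smul_eq_mul, ← Finset.mul_sum]
  simp only [Pi.sub_apply, Matrix.mulVec_sub, Finset.sum_sub_distrib, hx, hx', sub_self,
    zero_dotProduct, sub_zero]

/-- Feasible points at the parameter `e.1` with a prescribed duality gap, which vanishes for
`e.2 = 0`. The segment from a complementary solution `(x, y, s)` to a complementary solution for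
another parameter consists of such points, so these have the room to move continuously which
complementary solutions lack. -/
def relaxedSolSet (S : ParamSOCO m p d) (x : BlockVec d) :
    Set ((ℝ × ℝ) × BlockVec d × (Fin m → ℝ) × BlockVec d) :=
  {r | r.2.1 ∈ S.primalFeasible ∧ r.2.2 ∈ S.dualFeasible r.1.1 ∧
    ∑ i, r.2.1 i ⬝ᵥ r.2.2.2 i = r.1.2 * ∑ i, (x - r.2.1) i ⬝ᵥ S.cbar i}

theorem isClosed_relaxedSolSet : IsClosed (S.relaxedSolSet x) := by
  let X := (ℝ × ℝ) × BlockVec d × (Fin m → ℝ) × BlockVec d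
  have hprimal : Continuous fun r : X => r.2.1 := by fun_prop
  have hslack : Continuous fun r : X => r.2.2.2 := by fun_prop
  have hdual : Continuous fun r : X => (r.1.1, r.2.2) := by fun_prop
  have hgap : Continuous fun r : X => ∑ i, r.2.1 i ⬝ᵥ r.2.2.2 i :=
    continuous_finsetSum _ fun i _ =>
      ((continuous_apply i).comp hprimal).dotProduct ((continuous_apply i).comp hslack)
  have hdir : Continuous fun r : X => ∑ i, (x - r.2.1) i ⬝ᵥ S.cbar i :=
    continuous_finsetSum _ fun i _ =>
      ((continuous_apply i).comp (continuous_const.sub hprimal)).dotProduct continuous_const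
  exact (isClosed_primalFeasible.preimage hprimal).inter
    ((isClosed_setOf_mem_dualFeasible.preimage hdual).inter
      (isClosed_eq hgap (.mul (by fun_prop) hdir)))

theorem mem_relaxedSolSet_zero : ((ε, 0), x', y', s') ∈ S.relaxedSolSet x ↔
    S.IsComplSol ε x' y' s' := by
  simp only [relaxedSolSet, mem_ofPred_eq, zero_mul, IsComplSol]

theorem IsComplSol.add_smul_sub_mem_relaxedSolSet (h : S.IsComplSol ε₀ x y s)
    (h' : S.IsComplSol ε x' y' s') {t : ℝ} (ht : t ∈ Icc (0 : ℝ) 1) :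
    ((ε₀ + t * (ε - ε₀), (1 - t) * (ε - ε₀)), (x, y, s) + t • ((x', y', s') - (x, y, s))) ∈
      S.relaxedSolSet x := by
  have hdual := (convex_setOf_mem_dualFeasible (S := S)).add_smul_sub_mem
    (x := (ε₀, y, s)) (y := (ε, y', s')) h.2.1 h'.2.1 ht
  refine ⟨convex_primalFeasible.add_smul_sub_mem h.1 h'.1 ht, hdual, ?_⟩
  have hgap : ∑ i, (x i + t • (x' i - x i)) ⬝ᵥ (s i + t • (s' i - s i)) =
      (1 - t) * ∑ i, x i ⬝ᵥ s i + t * ∑ i, x' i ⬝ᵥ s' i -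
        t * (1 - t) * ∑ i, (x' - x) i ⬝ᵥ (s' - s) i := by
    simp only [Finset.mul_sum, ← Finset.sum_add_distrib, ← Finset.sum_sub_distrib]
    refine Finset.sum_congr rfl fun i _ => ?_
    simp only [Pi.sub_apply, add_dotProduct, dotProduct_add, smul_dotProduct, dotProduct_smul,
      sub_dotProduct, dotProduct_sub, smul_eq_mul]
    ring
  have hdir : ∑ i, (x - (x + t • (x' - x))) i ⬝ᵥ S.cbar i =
      -(t * ∑ i, (x' - x) i ⬝ᵥ S.cbar i) := by
    rw [sub_add_cancel_left, Finset.mul_sum, ← Finset.sum_neg_distrib]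
    refine Finset.sum_congr rfl fun i _ => ?_
    rw [Pi.neg_apply, Pi.smul_apply, neg_dotProduct, smul_dotProduct, smul_eq_mul]
  refine hgap.trans (Eq.trans ?_ (congrArg ((1 - t) * (ε - ε₀) * ·) hdir).symm)
  rw [h.2.2, h'.2.2, sum_sub_dotProduct_sub h.1.1 h'.1.1 h.2.1.1 h'.2.1.1]
  ring

theorem IsComplSol.eventually_mem (h : S.IsComplSol ε₀ x y s)
    (hunique : ∀ x' y' s', S.IsComplSol ε₀ x' y' s' → (x', y', s') = (x, y, s))
    {U : Set (BlockVec d × (Fin m → ℝ) × BlockVec d)} (hU : U ∈ 𝓝 (x, y, s)) :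
    ∀ᶠ ε in 𝓝 ε₀, ∀ x' y' s', S.IsComplSol ε x' y' s' → (x', y', s') ∈ U := by
  obtain ⟨δ, hδ, hball⟩ := Metric.mem_nhds_iff.1 hU
  have hsphere : ∀ᶠ e in 𝓝 ((ε₀, 0) : ℝ × ℝ), ∀ q ∈ Metric.sphere (x, y, s) δ,
      (e, q) ∉ S.relaxedSolSet x :=
    eventually_forall_notMem_of_isClosed isClosed_relaxedSolSet (isCompact_sphere _ _)
      fun q hq hrel => Metric.ne_of_mem_sphere hq hδ.ne'
        (hunique _ _ _ (mem_relaxedSolSet_zero.1 hrel))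
  have hsegment : ∀ᶠ ε in 𝓝 ε₀, ∀ t ∈ Icc (0 : ℝ) 1, ∀ q ∈ Metric.sphere (x, y, s) δ,
      ((ε₀ + t * (ε - ε₀), (1 - t) * (ε - ε₀)), q) ∉ S.relaxedSolSet x := by
    refine isCompact_Icc.eventually_forall_of_forall_eventually fun t _ => ?_
    have hcont : Continuous fun r : ℝ × ℝ =>
      (ε₀ + r.2 * (r.1 - ε₀), (1 - r.2) * (r.1 - ε₀)) := by fun_prop
    exact (hcont.tendsto' (ε₀, t) (ε₀, 0) (by simp)).eventually hsphere
  filter_upwards [hsegment] with ε hε x' y' s' h'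
  by_contra hnot
  have hdist : δ ≤ dist (x', y', s') (x, y, s) := not_lt.1 fun hlt => hnot (hball hlt)
  have hpos := hδ.trans_le hdist
  have ht : δ / dist (x', y', s') (x, y, s) ∈ Icc (0 : ℝ) 1 :=
    ⟨(div_pos hδ hpos).le, (div_le_one hpos).2 hdist⟩
  refine hε _ ht _ ?_ (h.add_smul_sub_mem_relaxedSolSet h' ht)
  rw [Metric.mem_sphere, dist_eq_norm, add_sub_cancel_left, norm_smul, Real.norm_eq_abs,
    abs_of_nonneg ht.1, ← dist_eq_norm, div_mul_cancel₀ _ hpos.ne']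

end Stability

end ParamSOCO

section ExtendByZero

variable {ι 𝕜 : Type*} [DecidableEq ι] [Semiring 𝕜] {J : Finset ι} {M : ι → Type*}
  [∀ i, AddCommMonoid (M i)] [∀ i, Module 𝕜 (M i)]

variable (𝕜 J M) in
/-- Extension by zero of a dependent family given on the finite set `J` only; it removes the case
distinctions from the first-order system. -/
def extendByZero : (∀ i : {i // i ∈ J}, M i) →ₗ[𝕜] ∀ i, M i :=
  LinearMap.pi fun i => if h : i ∈ J then LinearMap.proj (⟨i, h⟩ : {i // i ∈ J}) else 0

theorem extendByZero_of_mem (f : ∀ i : {i // i ∈ J}, M i) {i : ι} (h : i ∈ J) :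
    extendByZero 𝕜 J M f i = f ⟨i, h⟩ := by
  simp [extendByZero, h]

theorem extendByZero_of_notMem (f : ∀ i : {i // i ∈ J}, M i) {i : ι} (h : i ∉ J) :
    extendByZero 𝕜 J M f i = 0 := by
  simp [extendByZero, h]

theorem extendByZero_restrict {g : ∀ i, M i} (h : ∀ i ∉ J, g i = 0) :
    extendByZero 𝕜 J M (fun i => g i) = g := by
  funext i
  by_cases hi : i ∈ J
  · rw [extendByZero_of_mem _ hi]
  · rw [extendByZero_of_notMem _ hi, h i hi]

theorem extendByZero_injective : Function.Injective (extendByZero 𝕜 J M) := fun f g h => by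
  funext i
  simpa only [extendByZero_of_mem _ i.2] using congrFun h i.1

end ExtendByZero

namespace ParamSOCO

section FirstOrderSystem

variable {m p : ℕ} {d : Fin p → ℕ} {S : ParamSOCO m p d} {P : ConePartition p} {ε : ℝ}

/-- The slack variables `z^i`, with `z^i = 0` for `i ∉ R ∪ N ∪ T₃`. -/
abbrev slackExt : SlackVec d P →ₗ[ℝ] BlockVec d :=
  extendByZero ℝ P.slackIdx fun i => Fin (d i + 1) → ℝ

/-- The multipliers `v_i`, with `v_i = 0` for `i ∉ R ∪ T₃`. -/
abbrev multExt : ({i // i ∈ P.quadIdx} → ℝ) →ₗ[ℝ] (Fin p → ℝ) :=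
  extendByZero ℝ P.quadIdx fun _ => ℝ

theorem kktMap_eq (S : ParamSOCO m p d) (q : KKTVar m d P) (ε : ℝ) : S.kktMap P q ε =
    ((-(∑ i, S.A i *ᵥ q.u i) - S.b,
      fun i => -q.u i - (2 * multExt q.v i) • (reflMat (d i) *ᵥ slackExt q.z i),
      fun i => (S.A i)ᵀ *ᵥ q.w + slackExt q.z i - S.cost ε i,
      fun i => slackExt q.z i ⬝ᵥ (reflMat (d i) *ᵥ slackExt q.z i)) : KKTVar m d P) := by
  refine Prod.ext rfl (Prod.ext (funext fun i => ?_) (Prod.ext (funext fun i => ?_)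
    (funext fun i => ?_)))
  · by_cases hi : i.1 ∈ P.quadIdx
    · simp only [kktMap, dif_pos hi, extendByZero_of_mem _ hi, extendByZero_of_mem _ i.2]
    · simp only [kktMap, dif_neg hi, extendByZero_of_notMem _ hi, mul_zero, zero_smul, sub_zero]
  · by_cases hi : i ∈ P.slackIdx
    · simp only [kktMap, dif_pos hi, extendByZero_of_mem _ hi]
    · simp only [kktMap, dif_neg hi, extendByZero_of_notMem _ hi, add_zero]
  · simp only [kktMap,
      extendByZero_of_mem _ (ConePartition.mem_slackIdx_of_mem_quadIdx i.2)]

theorem kktMap_eq_zero_iff {q : KKTVar m d P} : S.kktMap P q ε = 0 ↔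
    ∑ i, S.A i *ᵥ (-q.u) i = S.b ∧
    (∀ i ∈ P.slackIdx,
      (-q.u) i = (2 * multExt q.v i) • (reflMat (d i) *ᵥ slackExt q.z i)) ∧
    (∀ i, (S.A i)ᵀ *ᵥ q.w + slackExt q.z i = S.cost ε i) ∧
    ∀ i ∈ P.quadIdx, slackExt q.z i ⬝ᵥ (reflMat (d i) *ᵥ slackExt q.z i) = 0 := by
  simp only [kktMap_eq, Prod.mk_eq_zero, funext_iff, Subtype.forall, Pi.zero_apply, sub_eq_zero,
    Pi.neg_apply, Matrix.mulVec_neg, Finset.sum_neg_distrib]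

/-- The differential of the first-order system at `q` in the direction `k`, for a fixed
parameter. -/
noncomputable def kktDeriv (S : ParamSOCO m p d) (q k : KKTVar m d P) : KKTVar m d P :=
  (-(∑ i, S.A i *ᵥ k.u i),
    fun i => -k.u i - ((2 * multExt k.v i) • (reflMat (d i) *ᵥ slackExt q.z i) +
      (2 * multExt q.v i) • (reflMat (d i) *ᵥ slackExt k.z i)),
    fun i => (S.A i)ᵀ *ᵥ k.w + slackExt k.z i,
    fun i => 2 * (slackExt q.z i ⬝ᵥ (reflMat (d i) *ᵥ slackExt k.z i)))

/-- The quadratic part of the first-order system, which does not depend on the data. -/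
noncomputable def kktQuad (k : KKTVar m d P) : KKTVar m d P :=
  (0, fun i => -((2 * multExt k.v i) • (reflMat (d i) *ᵥ slackExt k.z i)), 0,
    fun i => slackExt k.z i ⬝ᵥ (reflMat (d i) *ᵥ slackExt k.z i))

theorem kktMap_add_smul (q k : KKTVar m d P) (ε t : ℝ) :
    S.kktMap P (q + t • k) ε = S.kktMap P q ε + t • S.kktDeriv q k + t ^ 2 • kktQuad k := by
  simp only [kktMap_eq, kktDeriv, kktQuad, KKTVar.w, KKTVar.z, KKTVar.u, KKTVar.v, Prod.fst_add,
    Prod.snd_add, Prod.smul_fst, Prod.smul_snd, Prod.smul_mk, Prod.mk_add_mk, Prod.mk.injEq,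
    map_add, map_smul, Pi.add_apply, Pi.smul_apply, Matrix.mulVec_add, Matrix.mulVec_smul,
    Finset.sum_add_distrib, ← Finset.smul_sum, funext_iff, Pi.zero_apply]
  refine ⟨fun _ => ?_, fun _ _ => ?_, fun _ _ => ?_, fun i => ?_⟩
  iterate 3
    simp only [Pi.add_apply, Pi.sub_apply, Pi.neg_apply, Pi.smul_apply, smul_eq_mul]
    ring
  simp only [dotProduct_add, add_dotProduct, smul_dotProduct, dotProduct_smul, smul_eq_mul,
    dotProduct_reflMat_comm (slackExt k.2.1 i) (slackExt q.2.1 i)]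
  ring

theorem hasLineDerivAt_kktMap (q k : KKTVar m d P) (ε : ℝ) :
    HasLineDerivAt ℝ (fun q => S.kktMap P q ε) (S.kktDeriv q k) q k := by
  have hlin := ((hasDerivAt_id (0 : ℝ)).smul_const (S.kktDeriv q k)).const_add (S.kktMap P q ε)
  have hquad := (hasDerivAt_pow 2 (0 : ℝ)).smul_const (kktQuad k)
  simpa [HasLineDerivAt, kktMap_add_smul, Pi.add_def] using hlin.add hquad

theorem contDiff_kktMap (S : ParamSOCO m p d) (P : ConePartition p) {n : WithTop ℕ∞} :
    ContDiff ℝ n fun e : ℝ × KKTVar m d P => S.kktMap P e.2 e.1 := by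
  have hlinear {E F : Type} [NormedAddCommGroup E] [NormedSpace ℝ E] [FiniteDimensional ℝ E]
      [NormedAddCommGroup F] [NormedSpace ℝ F] (L : E →ₗ[ℝ] F) : ContDiff ℝ n L :=
    (LinearMap.toContinuousLinearMap L).contDiff
  have hmulVec {k l : ℕ} (M : Matrix (Fin k) (Fin l) ℝ) {f : ℝ × KKTVar m d P → Fin l → ℝ}
      (hf : ContDiff ℝ n f) : ContDiff ℝ n fun e => M *ᵥ f e := (hlinear M.mulVecLin).comp hf
  have hz : ∀ i, ContDiff ℝ n fun e : ℝ × KKTVar m d P => slackExt e.2.z i :=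
    contDiff_pi.1 ((hlinear _).comp contDiff_snd.snd.fst)
  have hv : ∀ i, ContDiff ℝ n fun e : ℝ × KKTVar m d P => multExt e.2.v i :=
    contDiff_pi.1 ((hlinear _).comp contDiff_snd.snd.snd.snd)
  have hu : ∀ i, ContDiff ℝ n fun e : ℝ × KKTVar m d P => e.2.u i :=
    contDiff_pi.1 contDiff_snd.snd.snd.fst
  have hcost : ∀ i, ContDiff ℝ n fun e : ℝ × KKTVar m d P => S.cost e.1 i := fun i =>
    contDiff_const.add (contDiff_fst.smul contDiff_const)
  simp only [kktMap_eq]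
  refine .prodMk ((ContDiff.sum fun i _ => hmulVec _ (hu i)).neg.sub contDiff_const)
    (.prodMk (contDiff_pi.2 fun i => ?_) (.prodMk (contDiff_pi.2 fun i => ?_)
      (contDiff_pi.2 fun i => ?_)))
  · exact (hu i).neg.sub ((contDiff_const.mul (hv i)).smul (hmulVec _ (hz i)))
  · exact ((hmulVec _ contDiff_snd.fst).add (hz i)).sub (hcost i)
  · exact ContDiff.sum fun j _ => (contDiff_pi.1 (hz i) j).mul
      (contDiff_pi.1 (hmulVec (reflMat (d i)) (hz i)) j)

theorem kktDeriv_eq_zero_iff {q k : KKTVar m d P} : S.kktDeriv q k = 0 ↔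
    ∑ i, S.A i *ᵥ k.u i = 0 ∧
    (∀ i ∈ P.slackIdx, -k.u i = (2 * multExt k.v i) • (reflMat (d i) *ᵥ slackExt q.z i) +
      (2 * multExt q.v i) • (reflMat (d i) *ᵥ slackExt k.z i)) ∧
    (∀ i, (S.A i)ᵀ *ᵥ k.w = -slackExt k.z i) ∧
    ∀ i ∈ P.quadIdx, slackExt q.z i ⬝ᵥ (reflMat (d i) *ᵥ slackExt k.z i) = 0 := by
  simp only [kktDeriv, Prod.mk_eq_zero, funext_iff, Subtype.forall, Pi.zero_apply, neg_eq_zero,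
    sub_eq_zero, mul_eq_zero, two_ne_zero, false_or, ← eq_neg_iff_add_eq_zero, Pi.neg_apply]

theorem dotProduct_slackExt_of_kktDeriv_eq_zero {q k : KKTVar m d P} (hk : S.kktDeriv q k = 0)
    (i : Fin p) : k.u i ⬝ᵥ slackExt k.z i =
      2 * multExt q.v i * -(slackExt k.z i ⬝ᵥ (reflMat (d i) *ᵥ slackExt k.z i)) := by
  obtain ⟨-, hstat, -, htan⟩ := kktDeriv_eq_zero_iff.1 hk
  by_cases hi : i ∈ P.slackIdx
  · have hcross : multExt k.v i * (slackExt q.z i ⬝ᵥ (reflMat (d i) *ᵥ slackExt k.z i)) = 0 := by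
      by_cases hi' : i ∈ P.quadIdx
      · rw [htan i hi', mul_zero]
      · rw [multExt, extendByZero_of_notMem _ hi', zero_mul]
    rw [← neg_neg (k.u i), hstat i hi, neg_dotProduct, add_dotProduct, smul_dotProduct,
      smul_dotProduct, dotProduct_comm _ (slackExt k.z i), dotProduct_comm _ (slackExt k.z i),
      dotProduct_reflMat_comm (slackExt k.z i) (slackExt q.z i), smul_eq_mul, smul_eq_mul,
      mul_assoc 2, hcross]
    ring
  · rw [slackExt, extendByZero_of_notMem _ hi, dotProduct_zero, zero_dotProduct, neg_zero,
      mul_zero]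

end FirstOrderSystem

section KKTPoint

variable {m p : ℕ} {d : Fin p → ℕ} {S : ParamSOCO m p d} {P : ConePartition p} {ε : ℝ}
  {x : BlockVec d} {y : Fin m → ℝ} {s : BlockVec d}

theorem HasPattern.mem_quadIdx_iff (h : HasPattern P x s) (hc : S.IsComplSol ε x y s)
    {i : Fin p} : i ∈ P.quadIdx ↔ SocBdry (s i) := by
  refine ⟨h.socBdry_dual, fun hs => Finset.mem_union.2 ?_⟩
  rw [h.R, h.T3]
  rcases mem_soc_iff.1 (hc.1.2 i) with hint | hbdry | hzero
  · exact absurd (eq_zero_of_dotProduct_eq_zero_of_mem_socInt hint (hc.2.1.2 i)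
      (hc.dotProduct_eq_zero i)) hs.ne_zero
  · exact Or.inl ⟨hbdry, hs⟩
  · exact Or.inr ⟨hzero, hs⟩

theorem HasPattern.mem_slackIdx_iff (h : HasPattern P x s) (hc : S.IsComplSol ε x y s)
    {i : Fin p} : i ∈ P.slackIdx ↔ s i ≠ 0 := by
  have hmem : i ∈ P.slackIdx ↔ i ∈ P.N ∨ i ∈ P.quadIdx := by
    simp only [ConePartition.slackIdx, ConePartition.quadIdx, Finset.mem_union]
    tauto
  have h0 : (0 : Fin (d i + 1) → ℝ) ∉ socInt (d i) := by simp [socInt]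
  rw [hmem, h.N, h.mem_quadIdx_iff hc]
  constructor
  · rintro (hint | hbdry)
    exacts [fun hzero => h0 (hzero ▸ hint), hbdry.ne_zero]
  · intro hs
    rcases mem_soc_iff.1 (hc.2.1.2 i) with hint | hbdry | hzero
    exacts [Or.inl hint, Or.inr hbdry, absurd hzero hs]

theorem HasPattern.mem_B_union_T1_union_T2_iff (h : HasPattern P x s)
    (hc : S.IsComplSol ε x y s) {i : Fin p} : i ∈ P.B ∪ P.T1 ∪ P.T2 ↔ s i = 0 := by
  simp only [Finset.mem_union, h.B, h.T1, h.T2]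
  constructor
  · rintro ((hint | hzero) | hzero)
    exacts [eq_zero_of_dotProduct_eq_zero_of_mem_socInt hint (hc.2.1.2 i)
      (hc.dotProduct_eq_zero i), hzero.2, hzero.1]
  · intro hs
    rcases mem_soc_iff.1 (hc.1.2 i) with hint | hbdry | hzero
    exacts [Or.inl (Or.inl hint), Or.inr ⟨hs, hbdry⟩, Or.inl (Or.inr ⟨hzero, hs⟩)]

theorem HasPattern.primal_eq_zero_of_mem_N (h : HasPattern P x s) (hc : S.IsComplSol ε x y s)
    {i : Fin p} (hi : i ∈ P.N) : x i = 0 :=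
  eq_zero_of_dotProduct_eq_zero_of_mem_socInt ((h.N i).1 hi) (hc.1.2 i)
    ((dotProduct_comm _ _).trans (hc.dotProduct_eq_zero i))

theorem mem_N_of_mem_slackIdx_of_notMem_quadIdx {i : Fin p} (hi : i ∈ P.slackIdx)
    (hi' : i ∉ P.quadIdx) : i ∈ P.N := by
  simp only [ConePartition.slackIdx, ConePartition.quadIdx, Finset.mem_union] at hi hi'
  tauto

/-- The zero of the first-order system that belongs to a complementary solution. -/
noncomputable def kktPoint (P : ConePartition p) (x : BlockVec d) (y : Fin m → ℝ)
    (s : BlockVec d) : KKTVar m d P :=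
  (y, fun i => s i, -x, fun i => x i 0 / (2 * s i 0))

theorem HasPattern.slackExt_kktPoint (h : HasPattern P x s) (hc : S.IsComplSol ε x y s) :
    slackExt (kktPoint P x y s).z = s :=
  extendByZero_restrict fun _ hi => not_not.1 ((h.mem_slackIdx_iff hc).not.1 hi)

theorem two_mul_multExt_kktPoint {i : Fin p} (hi : i ∈ P.quadIdx) :
    2 * multExt (kktPoint P x y s).v i = x i 0 / s i 0 := by
  rw [multExt, extendByZero_of_mem _ hi]
  change 2 * (x i 0 / (2 * s i 0)) = x i 0 / s i 0
  rw [← mul_div_assoc, mul_div_mul_left _ _ two_ne_zero]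

theorem HasPattern.primal_eq_smul_reflMat (h : HasPattern P x s) (hc : S.IsComplSol ε x y s)
    {i : Fin p} (hi : i ∈ P.slackIdx) :
    x i = (2 * multExt (kktPoint P x y s).v i) • (reflMat (d i) *ᵥ s i) := by
  by_cases hi' : i ∈ P.quadIdx
  · have hs := h.socBdry_dual hi'
    rw [two_mul_multExt_kktPoint hi']
    exact eq_smul_reflMat_of_dotProduct_eq_zero (hc.1.2 i) hs (hc.dotProduct_eq_zero i)
  · rw [multExt, extendByZero_of_notMem _ hi', mul_zero, zero_smul,
      h.primal_eq_zero_of_mem_N hc (mem_N_of_mem_slackIdx_of_notMem_quadIdx hi hi')]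

theorem HasPattern.kktMap_kktPoint (h : HasPattern P x s) (hc : S.IsComplSol ε x y s) :
    S.kktMap P (kktPoint P x y s) ε = 0 := by
  rw [kktMap_eq_zero_iff, h.slackExt_kktPoint hc, kktPoint, KKTVar.u, neg_neg]
  exact ⟨hc.1.1, fun i hi => h.primal_eq_smul_reflMat hc hi, hc.2.1.1,
    fun i hi => (socBdry_iff.1 (h.socBdry_dual hi)).1⟩

theorem HasPattern.dnFeasible_kktPoint (h : HasPattern P x s) (hc : S.IsComplSol ε x y s) :
    ((kktPoint P x y s).w, (kktPoint P x y s).z) ∈ S.dnFeasible P ε := by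
  refine ⟨fun i hi => ?_, fun i => hc.2.1.1 i, fun i hi => socBdry_iff.1 (h.socBdry_dual hi),
    fun i hi => (h.N i).1 hi⟩
  have hslack := hc.2.1.1 i
  rwa [show (y, s).2 i = 0 from (h.mem_B_union_T1_union_T2_iff hc).1 hi, add_zero] at hslack

theorem HasPattern.mem_dualFeasible_of_mem_dnFeasible (h : HasPattern P x s)
    (hc : S.IsComplSol ε x y s) {q : (Fin m → ℝ) × SlackVec d P} (hq : q ∈ S.dnFeasible P ε) :
    (q.1, slackExt q.2) ∈ S.dualFeasible ε := by
  obtain ⟨hzero, hslack, hquad, hint⟩ := hq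
  refine ⟨fun i => ?_, fun i => ?_⟩ <;> dsimp only <;> by_cases hi : i ∈ P.slackIdx
  · rw [slackExt, extendByZero_of_mem _ hi]
    exact hslack ⟨i, hi⟩
  · rw [slackExt, extendByZero_of_notMem _ hi, add_zero]
    rw [h.mem_slackIdx_iff hc, not_not, ← h.mem_B_union_T1_union_T2_iff hc] at hi
    exact hzero i hi
  · rw [slackExt, extendByZero_of_mem _ hi]
    by_cases hi' : i ∈ P.quadIdx
    · exact (socBdry_iff.2 (hquad ⟨i, hi⟩ hi')).mem_soc
    · exact mem_soc_iff.2
        (Or.inl (hint ⟨i, hi⟩ (mem_N_of_mem_slackIdx_of_notMem_quadIdx hi hi')))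
  · rw [slackExt, extendByZero_of_notMem _ hi]
    exact zero_mem_soc

theorem HasPattern.isDNGlobalOpt_kktPoint (h : HasPattern P x s) (hc : S.IsComplSol ε x y s) :
    S.IsDNGlobalOpt P ε (kktPoint P x y s).w (kktPoint P x y s).z := by
  refine ⟨h.dnFeasible_kktPoint hc, fun q hq => neg_le_neg ?_⟩
  calc S.b ⬝ᵥ q.1 ≤ S.primalObj ε x :=
        dotProduct_le_primalObj hc.1 (h.mem_dualFeasible_of_mem_dnFeasible hc hq)
    _ = S.b ⬝ᵥ y := hc.primalObj_eq

theorem IsNondegSol.eq_of_isDNGlobalOpt (h : S.IsNondegSol P ε x y s) {w : Fin m → ℝ}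
    {z : SlackVec d P} (hopt : S.IsDNGlobalOpt P ε w z) : (w, slackExt z) = (y, s) := by
  have hfeas := h.pattern.mem_dualFeasible_of_mem_dnFeasible h.isComplSol hopt.1
  refine h.dual_unique _ ⟨le_antisymm (dotProduct_le_optVal hfeas) ?_, hfeas⟩
  rw [← h.isComplSol.mem_dualOpt.1]
  exact EReal.coe_le_coe_iff.2
    (neg_le_neg_iff.1 (hopt.2 _ (h.pattern.dnFeasible_kktPoint h.isComplSol)))

theorem IsNondegSol.eq_kktPoint (h : S.IsNondegSol P ε x y s) {q : KKTVar m d P}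
    (hq : S.kktMap P q ε = 0) (hopt : S.IsDNGlobalOpt P ε q.w q.z) : q = kktPoint P x y s := by
  obtain ⟨hw, hz⟩ := Prod.mk.inj (h.eq_of_isDNGlobalOpt hopt)
  obtain ⟨hprimal, hstat, -, -⟩ := kktMap_eq_zero_iff.1 hq
  rw [hz] at hstat
  have hu : -q.u = x := by
    refine sub_eq_zero.1 (h.dualKerTrivial _ ?_ (fun i hi => ?_) fun i hi => ?_)
    · simp only [Pi.sub_apply, Matrix.mulVec_sub, Finset.sum_sub_distrib]
      rw [hprimal, h.isComplSol.1.1, sub_self]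
    · have hi' : i ∉ P.quadIdx := fun hi' =>
        (h.pattern.socBdry_dual hi').notMem_socInt ((h.pattern.N i).1 hi)
      rw [Pi.sub_apply, hstat i (by simp [ConePartition.slackIdx, hi]), multExt,
        extendByZero_of_notMem _ hi', mul_zero, zero_smul,
        h.pattern.primal_eq_zero_of_mem_N h.isComplSol hi, sub_zero]
    · have hi' := ConePartition.mem_slackIdx_of_mem_quadIdx hi
      rw [Pi.sub_apply, hstat i hi', h.pattern.primal_eq_smul_reflMat h.isComplSol hi',
        ← sub_smul]
      exact proportional_smul_self _ _
  have hv : q.v = (kktPoint P x y s).v := by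
    funext i
    have hi := ConePartition.mem_slackIdx_of_mem_quadIdx i.2
    have hsmul := (hstat i hi).symm.trans
      ((congrFun hu i).trans (h.pattern.primal_eq_smul_reflMat h.isComplSol hi))
    have hcoef := smul_left_injective ℝ
      (reflMat_mulVec_ne_zero (h.pattern.socBdry_dual i.2).ne_zero) hsmul
    simpa only [multExt, extendByZero_of_mem _ i.2, mul_right_inj' (two_ne_zero' ℝ)] using hcoef
  have hz' : q.z = (kktPoint P x y s).z := extendByZero_injective (𝕜 := ℝ)
    (hz.trans (h.pattern.slackExt_kktPoint h.isComplSol).symm)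
  exact Prod.ext hw (Prod.ext hz' (Prod.ext (neg_eq_iff_eq_neg.1 hu) hv))

end KKTPoint

section Nonsingularity

variable {m p : ℕ} {d : Fin p → ℕ} {S : ParamSOCO m p d} {P : ConePartition p} {ε : ℝ}
  {x : BlockVec d} {y : Fin m → ℝ} {s : BlockVec d}

theorem sum_dotProduct_slackExt_of_kktDeriv_eq_zero {q k : KKTVar m d P}
    (hk : S.kktDeriv q k = 0) : ∑ i, k.u i ⬝ᵥ slackExt k.z i = 0 := by
  obtain ⟨hsum, -, hdual, -⟩ := kktDeriv_eq_zero_iff.1 hk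
  calc ∑ i, k.u i ⬝ᵥ slackExt k.z i = -∑ i, k.u i ⬝ᵥ ((S.A i)ᵀ *ᵥ k.w) := by
        simp only [hdual, dotProduct_neg, Finset.sum_neg_distrib, neg_neg]
    _ = 0 := by rw [sum_dotProduct_transpose_mulVec, hsum, zero_dotProduct, neg_zero]

namespace IsNondegSol

/- The pairings `uⁱ · zⁱ` of a kernel direction add up to zero, and each of them is nonnegative
because the reflection is negative semidefinite on the tangent space of the cone boundary. -/
theorem dotProduct_slackExt_eq_zero (h : S.IsNondegSol P ε x y s) {k : KKTVar m d P}
    (hk : S.kktDeriv (kktPoint P x y s) k = 0) (i : Fin p) :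
    k.u i ⬝ᵥ slackExt k.z i = 0 := by
  obtain ⟨-, -, -, htan⟩ := kktDeriv_eq_zero_iff.1 hk
  rw [h.pattern.slackExt_kktPoint h.isComplSol] at htan
  have hnonneg : ∀ i, 0 ≤ k.u i ⬝ᵥ slackExt k.z i := fun i => by
    rw [dotProduct_slackExt_of_kktDeriv_eq_zero hk]
    by_cases hi : i ∈ P.quadIdx
    · have hs := h.pattern.socBdry_dual hi
      rw [two_mul_multExt_kktPoint hi]
      exact mul_nonneg
        (div_nonneg ((tailNorm_nonneg _).trans (h.isComplSol.1.2 i)) hs.pos.le)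
        (neg_nonneg.2 (dotProduct_reflMat_self_nonpos hs (htan i hi)))
    · rw [multExt, extendByZero_of_notMem _ hi, mul_zero, zero_mul]
  exact (Finset.sum_eq_zero_iff_of_nonneg fun i _ => hnonneg i).1
    (sum_dotProduct_slackExt_of_kktDeriv_eq_zero hk) i (Finset.mem_univ i)

theorem slackExt_eq_smul_of_kktDeriv_eq_zero (h : S.IsNondegSol P ε x y s) {k : KKTVar m d P}
    (hk : S.kktDeriv (kktPoint P x y s) k = 0) {i : Fin p} (hi : i ∈ P.R) :
    slackExt k.z i = (slackExt k.z i 0 / s i 0) • s i := by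
  obtain ⟨hx, hs⟩ := (h.pattern.R i).1 hi
  have hquad : i ∈ P.quadIdx := Finset.mem_union_left _ hi
  have htan := (kktDeriv_eq_zero_iff.1 hk).2.2.2 i hquad
  have hpair := (dotProduct_slackExt_of_kktDeriv_eq_zero hk i).symm.trans
    (h.dotProduct_slackExt_eq_zero hk i)
  rw [h.pattern.slackExt_kktPoint h.isComplSol] at htan
  rw [two_mul_multExt_kktPoint hquad, mul_eq_zero, neg_eq_zero] at hpair
  exact eq_smul_of_dotProduct_reflMat_self_nonneg hs htan
    (hpair.resolve_left (div_pos hx.pos hs.pos).ne').ge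

theorem w_eq_zero_of_kktDeriv_eq_zero (h : S.IsNondegSol P ε x y s) {k : KKTVar m d P}
    (hk : S.kktDeriv (kktPoint P x y s) k = 0) : k.w = 0 := by
  obtain ⟨-, -, hdual, -⟩ := kktDeriv_eq_zero_iff.1 hk
  have hzero : ∀ i ∈ P.B ∪ P.T1 ∪ P.T2, (S.A i)ᵀ *ᵥ k.w = 0 := fun i hi => by
    rw [h.pattern.mem_B_union_T1_union_T2_iff h.isComplSol] at hi
    rw [hdual, slackExt, extendByZero_of_notMem _
      ((h.pattern.mem_slackIdx_iff h.isComplSol).not_left.2 hi), neg_zero]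
  refine h.primalKerTrivial _ (fun i hi => hzero i (by simp [hi])) fun i hi => ?_
  rcases Finset.mem_union.1 hi with hR | hT2
  · obtain ⟨hx, -⟩ := (h.pattern.R i).1 hR
    have hs : s i = (s i 0 / x i 0) • (reflMat (d i) *ᵥ x i) :=
      eq_smul_reflMat_of_dotProduct_eq_zero (h.isComplSol.2.1.2 i) hx
        ((dotProduct_comm _ _).trans (h.isComplSol.dotProduct_eq_zero i))
    rw [hdual, h.slackExt_eq_smul_of_kktDeriv_eq_zero hk hR, hs, smul_smul, ← neg_smul]
    exact proportional_smul_self _ _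
  · rw [hzero i (by simp [hT2]), ← zero_smul ℝ (reflMat (d i) *ᵥ x i)]
    exact proportional_smul_self _ _

theorem eq_zero_of_kktDeriv_eq_zero (h : S.IsNondegSol P ε x y s) {k : KKTVar m d P}
    (hk : S.kktDeriv (kktPoint P x y s) k = 0) : k = 0 := by
  have hw := h.w_eq_zero_of_kktDeriv_eq_zero hk
  obtain ⟨hsum, hstat, hdual, -⟩ := kktDeriv_eq_zero_iff.1 hk
  have hZ : slackExt k.z = 0 := funext fun i => by
    rw [← neg_neg (slackExt k.z i), ← hdual, hw, Matrix.mulVec_zero, neg_zero, Pi.zero_apply]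
  have hz : k.z = 0 := extendByZero_injective (𝕜 := ℝ) (hZ.trans (map_zero _).symm)
  simp only [h.pattern.slackExt_kktPoint h.isComplSol, hZ, Pi.zero_apply, Matrix.mulVec_zero,
    smul_zero, add_zero, neg_eq_iff_eq_neg, ← neg_smul] at hstat
  have hu : k.u = 0 := by
    refine h.dualKerTrivial _ hsum (fun i hi => ?_) fun i hi => ?_
    · have hi' : i ∉ P.quadIdx := fun hi' =>
        (h.pattern.socBdry_dual hi').notMem_socInt ((h.pattern.N i).1 hi)
      rw [hstat i (by simp [ConePartition.slackIdx, hi]), multExt, extendByZero_of_notMem _ hi',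
        mul_zero, neg_zero, zero_smul]
    · rw [hstat i (ConePartition.mem_slackIdx_of_mem_quadIdx hi)]
      exact proportional_smul_self _ _
  have hv : k.v = 0 := funext fun i => by
    have hsmul := (hstat i (ConePartition.mem_slackIdx_of_mem_quadIdx i.2)).symm.trans
      (congrFun hu i)
    have hcoef := (smul_eq_zero.1 hsmul).resolve_right
      (reflMat_mulVec_ne_zero (h.pattern.socBdry_dual i.2).ne_zero)
    simpa only [multExt, extendByZero_of_mem _ i.2, neg_eq_zero, mul_eq_zero, two_ne_zero,
      false_or, Pi.zero_apply] using hcoef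
  exact Prod.ext hw (Prod.ext hz (Prod.ext hu hv))

end IsNondegSol

theorem kktDeriv_eq_fderiv (q k : KKTVar m d P) (ε : ℝ) : S.kktDeriv q k =
    (fderiv ℝ (fun e : ℝ × KKTVar m d P => S.kktMap P e.2 e.1) (ε, q) ∘L
      .inr ℝ ℝ (KKTVar m d P)) k := by
  have hline := (S.contDiff_kktMap P (n := 1)).differentiable one_ne_zero (ε, q)
    |>.hasFDerivAt.hasLineDerivAt (0, k)
  have heq : HasLineDerivAt ℝ (fun e : ℝ × KKTVar m d P => S.kktMap P e.2 e.1)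
      (S.kktDeriv q k) (ε, q) (0, k) := by
    simpa [HasLineDerivAt] using S.hasLineDerivAt_kktMap q k ε
  exact heq.unique hline

theorem IsNondegSol.isInvertible_fderiv_kktMap (h : S.IsNondegSol P ε x y s) :
    (fderiv ℝ (fun e : ℝ × KKTVar m d P => S.kktMap P e.2 e.1) (ε, kktPoint P x y s) ∘L
      .inr ℝ ℝ (KKTVar m d P)).IsInvertible := by
  set L := fderiv ℝ (fun e : ℝ × KKTVar m d P => S.kktMap P e.2 e.1) (ε, kktPoint P x y s) ∘L
    .inr ℝ ℝ (KKTVar m d P)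
  have hinj : Function.Injective L := (injective_iff_map_eq_zero L).2 fun k hk =>
    h.eq_zero_of_kktDeriv_eq_zero ((kktDeriv_eq_fderiv _ k ε).trans hk)
  exact ⟨(LinearEquiv.ofInjectiveEndo (L : KKTVar m d P →ₗ[ℝ] KKTVar m d P)
    hinj).toContinuousLinearEquiv, ContinuousLinearMap.ext fun _ => rfl⟩

end Nonsingularity

end ParamSOCO

section ConstantGerms

theorem eventually_eq_iff_iteratedDeriv_eq_zero {𝕜 E : Type*} [NontriviallyNormedField 𝕜]
    [CharZero 𝕜] [NormedAddCommGroup E] [NormedSpace 𝕜 E] [CompleteSpace E] {f : 𝕜 → E} {a : 𝕜}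
    (hf : AnalyticAt 𝕜 f a) :
    (∀ᶠ t in 𝓝 a, f t = f a) ↔ ∀ k : ℕ, 1 ≤ k → iteratedDeriv k f a = 0 := by
  have hg : AnalyticAt 𝕜 (fun t => f t - f a) a := hf.sub analyticAt_const
  have hderiv (k : ℕ) : iteratedDeriv (k + 1) (fun t => f t - f a) a =
      iteratedDeriv (k + 1) f a := by
    rw [iteratedDeriv_succ', iteratedDeriv_succ',
      show deriv (fun t => f t - f a) = deriv f from funext fun _ => deriv_sub_const _]
  calc (∀ᶠ t in 𝓝 a, f t = f a)
      ↔ analyticOrderAt (fun t => f t - f a) a = ⊤ := by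
        simp only [analyticOrderAt_eq_top, sub_eq_zero]
    _ ↔ ∀ k : ℕ, iteratedDeriv k (fun t => f t - f a) a = 0 := by
        rw [ENat.eq_top_iff_forall_ge]
        simp only [natCast_le_analyticOrderAt_iff_iteratedDeriv_eq_zero hg]
        exact ⟨fun h k => h (k + 1) k k.lt_succ_self, fun h _ k _ => h k⟩
    _ ↔ ∀ k : ℕ, 1 ≤ k → iteratedDeriv k f a = 0 := by
        rw [← Nat.and_forall_add_one]
        simp only [hderiv, iteratedDeriv_zero, sub_self, true_and]
        exact ⟨fun h k hk => Nat.sub_add_cancel hk ▸ h (k - 1), fun h k => h _ k.succ_pos⟩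

end ConstantGerms

section Strata

variable {k : ℕ} {a : Fin (k + 1) → ℝ}

/-- Membership in the same one of the three strata of the second-order cone: the interior, the
boundary without the apex, and the apex. -/
structure SameStratum (a a' : Fin (k + 1) → ℝ) : Prop where
  socInt : a ∈ socInt k ↔ a' ∈ socInt k
  socBdry : SocBdry a ↔ SocBdry a'
  zero : a = 0 ↔ a' = 0

theorem SameStratum.mem_soc {a' : Fin (k + 1) → ℝ} (h : SameStratum a a') (ha : a ∈ soc k) :
    a' ∈ soc k := by
  rwa [mem_soc_iff, h.socInt, h.socBdry, h.zero, ← mem_soc_iff] at ha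

theorem eventually_sameStratum (ha : a ∈ soc k) :
    ∀ᶠ a' in 𝓝 a, (SocBdry a → a' ⬝ᵥ (reflMat k *ᵥ a') = 0) → (a = 0 → a' = 0) →
      SameStratum a a' := by
  have h0 : (0 : Fin (k + 1) → ℝ) ∉ socInt k := by simp [socInt]
  rcases mem_soc_iff.1 ha with hint | hbdry | rfl
  · filter_upwards [isOpen_socInt.mem_nhds hint] with a' ha' _ _
    exact ⟨iff_of_true hint ha', iff_of_false (·.notMem_socInt hint) (·.notMem_socInt ha'),
      iff_of_false (fun h => h0 (h ▸ hint)) fun h => h0 (h ▸ ha')⟩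
  · filter_upwards [(continuous_apply 0).continuousAt.eventually_const_lt hbdry.pos]
      with a' hpos hquad _
    have hbdry' := socBdry_iff.2 ⟨hquad hbdry, hpos⟩
    exact ⟨iff_of_false hbdry.notMem_socInt hbdry'.notMem_socInt, iff_of_true hbdry hbdry',
      iff_of_false hbdry.ne_zero hbdry'.ne_zero⟩
  · refine .of_forall fun a' _ hzero => ?_
    rw [hzero rfl]
    exact ⟨.rfl, .rfl, .rfl⟩

end Strata

namespace ParamSOCO

variable {m p : ℕ} {d : Fin p → ℕ} {S : ParamSOCO m p d} {P : ConePartition p} {ε ε₀ ρ : ℝ}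
  {x : BlockVec d} {y : Fin m → ℝ} {s : BlockVec d}

section SolutionMaps

theorem IsNondegSol.exists_solution_branch (h : S.IsNondegSol P ε x y s) :
    ∃ χ : ℝ → KKTVar m d P, AnalyticAt ℝ χ ε ∧ χ ε = kktPoint P x y s ∧
      (∀ᶠ t in 𝓝 ε, S.kktMap P (χ t) t = 0) ∧
      ∀ᶠ e in 𝓝 (ε, kktPoint P x y s), S.kktMap P e.2 e.1 = 0 → e.2 = χ e.1 := by
  have hsmooth : ContDiffAt ℝ ⊤ (fun e : ℝ × KKTVar m d P => S.kktMap P e.2 e.1)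
    (ε, kktPoint P x y s) := (S.contDiff_kktMap P).contDiffAt
  have hinv := h.isInvertible_fderiv_kktMap
  have hzero := h.pattern.kktMap_kktPoint h.isComplSol
  refine ⟨hsmooth.implicitFunction (by simp) hinv,
    (hsmooth.contDiffAt_implicitFunction (by simp) hinv).analyticAt,
    hsmooth.implicitFunction_apply_self (by simp) hinv, ?_, ?_⟩
  · filter_upwards [hsmooth.eventually_apply_implicitFunction (by simp) hinv] with t ht
    exact ht.trans hzero
  · filter_upwards [hsmooth.eventually_apply_eq_iff_implicitFunction (by simp) hinv] with e he he'
    exact (he.1 (he'.trans hzero.symm)).symm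

theorem IsNondegSol.exists_isSolutionMap (h : S.IsNondegSol (S.partition ε₀) ε₀ x y s) :
    ∃ ρ χ, S.IsSolutionMap ε₀ ρ χ := by
  obtain ⟨χ, hanalytic, hself, hzero, -⟩ := h.exists_solution_branch
  obtain ⟨ρ, hρ, hball⟩ :=
    Metric.eventually_nhds_iff_ball.1 (hanalytic.eventually_analyticAt.and hzero)
  rw [Real.ball_eq_Ioo] at hball
  refine ⟨ρ, χ, hρ, fun t ht => (hball t ht).1, fun t ht => (hball t ht).2, ?_⟩
  rw [hself]
  exact h.pattern.isDNGlobalOpt_kktPoint h.isComplSol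

namespace IsSolutionMap

variable {χ χ' : ℝ → KKTVar m d (S.partition ε₀)}

theorem mem_Ioo (hχ : S.IsSolutionMap ε₀ ρ χ) : ε₀ ∈ Ioo (ε₀ - ρ) (ε₀ + ρ) :=
  ⟨sub_lt_self _ hχ.1, lt_add_of_pos_right _ hχ.1⟩

theorem analyticAt (hχ : S.IsSolutionMap ε₀ ρ χ) : AnalyticAt ℝ χ ε₀ := hχ.2.1 ε₀ hχ.mem_Ioo

theorem eventually_kktMap_eq_zero (hχ : S.IsSolutionMap ε₀ ρ χ) :
    ∀ᶠ t in 𝓝 ε₀, S.kktMap (S.partition ε₀) (χ t) t = 0 := by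
  filter_upwards [isOpen_Ioo.mem_nhds hχ.mem_Ioo] with t ht using hχ.2.2.1 t ht

theorem apply_self (hχ : S.IsSolutionMap ε₀ ρ χ)
    (h : S.IsNondegSol (S.partition ε₀) ε₀ x y s) : χ ε₀ = kktPoint (S.partition ε₀) x y s :=
  h.eq_kktPoint (hχ.2.2.1 ε₀ hχ.mem_Ioo) hχ.2.2.2

theorem tendsto_kktPoint (hχ : S.IsSolutionMap ε₀ ρ χ)
    (h : S.IsNondegSol (S.partition ε₀) ε₀ x y s) :
    Tendsto χ (𝓝 ε₀) (𝓝 (kktPoint (S.partition ε₀) x y s)) :=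
  hχ.apply_self h ▸ hχ.analyticAt.continuousAt

theorem eventually_eq_of_kktMap_eq_zero (hχ : S.IsSolutionMap ε₀ ρ χ)
    (h : S.IsNondegSol (S.partition ε₀) ε₀ x y s) :
    ∀ᶠ e in 𝓝 (ε₀, kktPoint (S.partition ε₀) x y s),
      S.kktMap (S.partition ε₀) e.2 e.1 = 0 → e.2 = χ e.1 := by
  obtain ⟨ξ, -, -, -, hξ⟩ := h.exists_solution_branch
  have hχξ : ∀ᶠ t in 𝓝 ε₀, χ t = ξ t := by
    filter_upwards [(tendsto_id.prodMk_nhds (hχ.tendsto_kktPoint h)).eventually hξ,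
      hχ.eventually_kktMap_eq_zero] with t ht ht0 using ht ht0
  filter_upwards [hξ, continuousAt_fst.eventually hχξ] with e he he' he0
  exact (he he0).trans he'.symm

theorem eqOn (hχ : S.IsSolutionMap ε₀ ρ χ) (hχ' : S.IsSolutionMap ε₀ ρ χ')
    (h : S.IsNondegSol (S.partition ε₀) ε₀ x y s) : EqOn χ χ' (Ioo (ε₀ - ρ) (ε₀ + ρ)) := by
  refine hχ.2.1.eqOn_of_preconnected_of_eventuallyEq hχ'.2.1 isPreconnected_Ioo hχ.mem_Ioo ?_
  filter_upwards [(tendsto_id.prodMk_nhds (hχ.tendsto_kktPoint h)).eventually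
    (hχ'.eventually_eq_of_kktMap_eq_zero h), hχ.eventually_kktMap_eq_zero] with t ht ht0
    using ht ht0

end IsSolutionMap

end SolutionMaps

section Degeneracy

/-- The equations which the blocks in `T₁`, `T₂`, `T₃` of a zero of the first-order system have to
satisfy for the strata of the cones to be those prescribed by `P`. -/
structure HasDegenerateBlocks (q : KKTVar m d P) : Prop where
  T1 : ∀ i ∈ P.T1, q.u i = 0
  T2 : ∀ i ∈ P.T2, q.u i 0 ^ 2 - tailNorm (q.u i) ^ 2 = 0
  T3 : ∀ i (hi : i ∈ P.T3), q.v ⟨i, ConePartition.mem_quadIdx_of_mem_T3 hi⟩ = 0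

theorem HasPattern.hasDegenerateBlocks_kktPoint (h : HasPattern P x s) :
    HasDegenerateBlocks (kktPoint P x y s) where
  T1 i hi := neg_eq_zero.2 ((h.T1 i).1 hi).1
  T2 i hi := by
    rw [← dotProduct_reflMat_self]
    change (-x i) ⬝ᵥ (reflMat (d i) *ᵥ -x i) = 0
    rw [Matrix.mulVec_neg, neg_dotProduct_neg]
    exact (socBdry_iff.1 ((h.T2 i).1 hi).2).1
  T3 i hi := by
    change x i 0 / (2 * s i 0) = 0
    rw [((h.T3 i).1 hi).1, Pi.zero_apply, zero_div]

theorem derivativesVanish_iff {χ : ℝ → KKTVar m d (S.partition ε₀)} (hχ : AnalyticAt ℝ χ ε₀)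
    (h₀ : HasDegenerateBlocks (χ ε₀)) :
    S.DerivativesVanish ε₀ χ ↔ ∀ᶠ t in 𝓝 ε₀, HasDegenerateBlocks (χ t) := by
  have hu : ∀ i j, AnalyticAt ℝ (fun t => (χ t).u i j) ε₀ := fun i => analyticAt_pi_iff.1
    (analyticAt_pi_iff.1 (analyticAt_fst.comp (analyticAt_snd.comp (analyticAt_snd.comp hχ))) i)
  have hv : ∀ i, AnalyticAt ℝ (fun t => (χ t).v i) ε₀ :=
    analyticAt_pi_iff.1 (analyticAt_snd.comp (analyticAt_snd.comp (analyticAt_snd.comp hχ)))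
  have hgap : ∀ i, AnalyticAt ℝ (fun t => (χ t).u i 0 ^ 2 - tailNorm ((χ t).u i) ^ 2) ε₀ :=
    fun i => by
      simp only [tailNorm_sq]
      exact ((hu i 0).pow 2).sub (Finset.analyticAt_fun_sum _ fun j _ =>
        (hu i j.succ).mul (hu i j.succ))
  have hiff (q : KKTVar m d (S.partition ε₀)) : HasDegenerateBlocks q ↔
      (∀ i ∈ (S.partition ε₀).T1, ∀ j, q.u i j = 0) ∧
      (∀ i ∈ (S.partition ε₀).T2, q.u i 0 ^ 2 - tailNorm (q.u i) ^ 2 = 0) ∧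
      ∀ i (hi : i ∈ (S.partition ε₀).T3),
        q.v ⟨i, ConePartition.mem_quadIdx_of_mem_T3 hi⟩ = 0 :=
    ⟨fun h => ⟨fun i hi => congrFun (h.T1 i hi), h.T2, h.T3⟩,
      fun h => ⟨fun i hi => funext (h.1 i hi), h.2.1, h.2.2⟩⟩
  simp only [hiff, eventually_and, eventually_all]
  refine and_congr ?_ (and_congr ?_ ?_)
  · refine forall₂_congr fun i hi => forall_congr' fun j => ?_
    rw [← eventually_eq_iff_iteratedDeriv_eq_zero (hu i j), congrFun (h₀.T1 i hi) j, Pi.zero_apply]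
  · refine forall₂_congr fun i hi => ?_
    rw [← eventually_eq_iff_iteratedDeriv_eq_zero (hgap i), h₀.T2 i hi]
  · refine forall₂_congr fun i hi => ?_
    rw [← eventually_eq_iff_iteratedDeriv_eq_zero (hv _), h₀.T3 i hi]

end Degeneracy

section Persistence

theorem HasPattern.congr {x' s' : BlockVec d} (h : HasPattern P x s)
    (hx : ∀ i, SameStratum (x i) (x' i)) (hs : ∀ i, SameStratum (s i) (s' i)) :
    HasPattern P x' s' where
  B i := (h.B i).trans (hx i).socInt
  N i := (h.N i).trans (hs i).socInt
  R i := (h.R i).trans (and_congr (hx i).socBdry (hs i).socBdry)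
  T1 i := (h.T1 i).trans (and_congr (hx i).zero (hs i).zero)
  T2 i := (h.T2 i).trans (and_congr (hs i).zero (hx i).socBdry)
  T3 i := (h.T3 i).trans (and_congr (hx i).zero (hs i).socBdry)

theorem tendsto_neg_u_kktPoint :
    Tendsto (fun q : KKTVar m d P => -q.u) (𝓝 (kktPoint P x y s)) (𝓝 x) :=
  Continuous.tendsto' (by fun_prop) _ _ (neg_neg x)

theorem HasPattern.tendsto_slackExt_kktPoint (h : HasPattern P x s)
    (hc : S.IsComplSol ε x y s) :
    Tendsto (fun q : KKTVar m d P => slackExt q.z) (𝓝 (kktPoint P x y s)) (𝓝 s) :=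
  Continuous.tendsto' (slackExt.continuous_of_finiteDimensional.comp (by fun_prop)) _ _
    (h.slackExt_kktPoint hc)

theorem HasPattern.eventually_sameStratum_dual (h : HasPattern P x s)
    (hc : S.IsComplSol ε x y s) :
    ∀ᶠ q in 𝓝 (kktPoint P x y s), ∀ t, S.kktMap P q t = 0 →
      ∀ i, SameStratum (s i) (slackExt q.z i) := by
  have hnear : ∀ᶠ q in 𝓝 (kktPoint P x y s), ∀ i, _ := eventually_all.2 fun i =>
    (tendsto_pi_nhds.1 (h.tendsto_slackExt_kktPoint hc) i).eventually
      (eventually_sameStratum (hc.2.1.2 i))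
  filter_upwards [hnear] with q hq t ht i
  refine hq i (fun hbdry => ?_) fun hzero => ?_
  · exact (kktMap_eq_zero_iff.1 ht).2.2.2 i ((h.mem_quadIdx_iff hc).2 hbdry)
  · exact extendByZero_of_notMem _ ((h.mem_slackIdx_iff hc).not_left.2 hzero)

theorem HasPattern.eventually_sameStratum_primal (h : HasPattern P x s)
    (hc : S.IsComplSol ε x y s) :
    ∀ᶠ q in 𝓝 (kktPoint P x y s), ∀ t, S.kktMap P q t = 0 → HasDegenerateBlocks q →
      ∀ i, SameStratum (x i) ((-q.u) i) := by
  have hnear : ∀ᶠ q in 𝓝 (kktPoint P x y s), ∀ i, _ := eventually_all.2 fun i =>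
    (tendsto_pi_nhds.1 (tendsto_neg_u_kktPoint (y := y) (s := s)) i).eventually
      (eventually_sameStratum (hc.1.2 i))
  filter_upwards [hnear] with q hq t ht hdeg i
  obtain ⟨-, hstat, -, hquad⟩ := kktMap_eq_zero_iff.1 ht
  refine hq i (fun hbdry => ?_) fun hzero => ?_
  · by_cases hs : s i = 0
    · rw [Pi.neg_apply, Matrix.mulVec_neg, neg_dotProduct_neg, dotProduct_reflMat_self]
      exact hdeg.T2 i ((h.T2 i).2 ⟨hs, hbdry⟩)
    · have hslack := (h.mem_slackIdx_iff hc).2 hs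
      have hi : i ∈ P.quadIdx := by
        by_contra hi
        exact hbdry.ne_zero (h.primal_eq_zero_of_mem_N hc
          (mem_N_of_mem_slackIdx_of_notMem_quadIdx hslack hi))
      rw [hstat i hslack, Matrix.mulVec_smul, reflMat_mulVec_mulVec, smul_dotProduct,
        dotProduct_smul, dotProduct_comm, hquad i hi, smul_zero, smul_zero]
  · rcases mem_soc_iff.1 (hc.2.1.2 i) with hint | hbdry | hs
    · have hi := (h.N i).2 hint
      have hi' : i ∉ P.quadIdx := fun hi' => (h.socBdry_dual hi').notMem_socInt hint
      rw [hstat i (by simp [ConePartition.slackIdx, hi]), multExt, extendByZero_of_notMem _ hi',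
        mul_zero, zero_smul]
    · have hi := (h.T3 i).2 ⟨hzero, hbdry⟩
      have hi' := ConePartition.mem_quadIdx_of_mem_T3 hi
      rw [hstat i (ConePartition.mem_slackIdx_of_mem_quadIdx hi'), multExt,
        extendByZero_of_mem _ hi', hdeg.T3 i hi, mul_zero, zero_smul]
    · rw [Pi.neg_apply, hdeg.T1 i ((h.T1 i).2 ⟨hzero, hs⟩), neg_zero]

theorem IsNondegSol.eventually_of_kktMap_eq_zero (h : S.IsNondegSol P ε x y s) :
    ∀ᶠ q in 𝓝 (kktPoint P x y s), ∀ t, S.kktMap P q t = 0 → HasDegenerateBlocks q →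
      S.IsNondegSol P t (-q.u) q.w (slackExt q.z) := by
  filter_upwards [h.pattern.eventually_sameStratum_primal h.isComplSol,
    h.pattern.eventually_sameStratum_dual h.isComplSol,
    tendsto_neg_u_kktPoint.eventually h.primalKerTrivial.eventually,
    (h.pattern.tendsto_slackExt_kktPoint h.isComplSol).eventually h.dualKerTrivial.eventually]
    with q hprimal hdual hP hD t ht hdeg
  have hx := hprimal t ht hdeg
  have hs := hdual t ht
  have hxK : ∀ i, (-q.u) i ∈ soc (d i) := fun i => (hx i).mem_soc (h.isComplSol.1.2 i)
  have hsK : ∀ i, slackExt q.z i ∈ soc (d i) := fun i => (hs i).mem_soc (h.isComplSol.2.1.2 i)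
  obtain ⟨hsum, hstat, hslack, hquad⟩ := kktMap_eq_zero_iff.1 ht
  refine ⟨⟨⟨hsum, hxK⟩, ⟨hslack, hsK⟩, Finset.sum_eq_zero fun i _ => ?_⟩,
    h.pattern.congr hx hs, hP, hD⟩
  by_cases hi : i ∈ P.slackIdx
  · rw [hstat i hi, smul_dotProduct, dotProduct_comm, smul_eq_mul]
    by_cases hi' : i ∈ P.quadIdx
    · rw [hquad i hi', mul_zero]
    · rw [multExt, extendByZero_of_notMem _ hi', mul_zero, zero_mul]
  · rw [slackExt, extendByZero_of_notMem _ hi, dotProduct_zero]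

theorem IsNondegSol.isComplSol_of_forall_mem_T1 (h : S.IsNondegSol P ε₀ x y s)
    (hT1 : ∀ i, i ∈ P.T1) : S.IsComplSol ε x y s := by
  have hx : ∀ i, x i = 0 := fun i => ((h.pattern.T1 i).1 (hT1 i)).1
  have hs : ∀ i, s i = 0 := fun i => ((h.pattern.T1 i).1 (hT1 i)).2
  have hm : ∀ g : Fin m → ℝ, g = 0 := fun g => by
    refine h.primalKerTrivial g (fun i hi => ?_) fun i hi => ?_
    · have hint := (h.pattern.B i).1 hi
      simp [hx i, socInt] at hint
    · exact absurd (hx i) (h.pattern.socBdry_primal hi).ne_zero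
  have hblock : ∀ g : BlockVec d, g = 0 := fun g => by
    refine h.dualKerTrivial g (hm _) (fun i hi => ?_) fun i hi => ?_
    · have hint := (h.pattern.N i).1 hi
      simp [hs i, socInt] at hint
    · exact absurd (hs i) (h.pattern.socBdry_dual hi).ne_zero
  have hcost : S.cost ε = S.cost ε₀ := (hblock _).trans (hblock _).symm
  have hdual := h.isComplSol.2.1
  rw [dualFeasible, mem_ofPred_eq, ← hcost] at hdual
  exact ⟨h.isComplSol.1, hdual, h.isComplSol.2.2⟩

/- Without a complementary solution at `ε` the condition defining `T₁` holds vacuously, so that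
every index lies in `T₁`; nondegeneracy then leaves only the case in which all blocks and all
multipliers are trivial. -/
theorem IsNondegSol.exists_isComplSol (h : S.IsNondegSol P ε₀ x y s) (hP : S.partition ε = P) :
    ∃ x' y' s', S.IsComplSol ε x' y' s' := by
  classical
  by_contra hno
  refine hno ⟨x, y, s, h.isComplSol_of_forall_mem_T1 fun i => ?_⟩
  rw [← hP]
  exact Finset.mem_filter.2 ⟨Finset.mem_univ i, fun x' hx' q hq =>
    absurd ⟨x', q.1, q.2, isComplSol_of_mem_opt hx' hq⟩ hno⟩

theorem IsNondegSol.eventually_exists_of_partition_eq (h : S.IsNondegSol P ε₀ x y s)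
    {U : Set (BlockVec d × (Fin m → ℝ) × BlockVec d)} (hU : U ∈ 𝓝 (x, y, s)) :
    ∀ᶠ t in 𝓝 ε₀, S.partition t = P →
      ∃ x' y' s', (x', y', s') ∈ U ∧ S.IsNondegSol P t x' y' s' := by
  have hprimal : Tendsto (fun r : BlockVec d × (Fin m → ℝ) × BlockVec d => r.1)
      (𝓝 (x, y, s)) (𝓝 x) := Continuous.tendsto (by fun_prop) _
  have hdual : Tendsto (fun r : BlockVec d × (Fin m → ℝ) × BlockVec d => r.2.2)
      (𝓝 (x, y, s)) (𝓝 s) := Continuous.tendsto (by fun_prop) _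
  have hx0 : ∀ᶠ x' in 𝓝 x, ∀ i ∈ P.R ∪ P.T2, x' i ≠ 0 :=
    (Finset.eventually_all _).2 fun i hi => (continuous_apply i).continuousAt.eventually_ne
      (h.pattern.socBdry_primal hi).ne_zero
  have hs0 : ∀ᶠ s' in 𝓝 s, ∀ i ∈ P.R ∪ P.T3, s' i ≠ 0 :=
    (Finset.eventually_all _).2 fun i hi => (continuous_apply i).continuousAt.eventually_ne
      (h.pattern.socBdry_dual hi).ne_zero
  have hnear := (hprimal.eventually (hx0.and h.primalKerTrivial.eventually)).and
    (hdual.eventually (hs0.and h.dualKerTrivial.eventually))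
  filter_upwards [h.isComplSol.eventually_mem (fun x' y' s' h' => Prod.ext
    (h.primal_unique _ h'.mem_primalOpt) (h.dual_unique _ h'.mem_dualOpt))
    (inter_mem hU hnear)] with t ht hpart
  obtain ⟨x', y', s', h'⟩ := h.exists_isComplSol hpart
  obtain ⟨hmem, ⟨hx', hP'⟩, hs', hD'⟩ := ht x' y' s' h'
  subst hpart
  exact ⟨x', y', s', hmem,
    isNondegSol_partition h'.mem_primalOpt h'.mem_dualOpt hx' hs' hP' hD'⟩

theorem HasPattern.tendsto_kktPoint (h : HasPattern P x s) :
    Tendsto (fun r : BlockVec d × (Fin m → ℝ) × BlockVec d => kktPoint P r.1 r.2.1 r.2.2)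
      (𝓝 (x, y, s)) (𝓝 (kktPoint P x y s)) := by
  refine ContinuousAt.prodMk (by fun_prop) (.prodMk (by fun_prop) (.prodMk (by fun_prop) ?_))
  refine continuousAt_pi.2 fun i => ContinuousAt.div (by fun_prop) (by fun_prop) ?_
  exact (mul_pos two_pos (h.socBdry_dual i.2).pos).ne'

theorem IsSolutionMap.eventually_eq_kktPoint {χ : ℝ → KKTVar m d (S.partition ε₀)}
    (hχ : S.IsSolutionMap ε₀ ρ χ) (h : S.IsNondegSol (S.partition ε₀) ε₀ x y s) :
    ∀ᶠ t in 𝓝 ε₀, S.partition t = S.partition ε₀ → ∃ x' y' s',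
      S.IsNondegSol (S.partition ε₀) t x' y' s' ∧ χ t = kktPoint (S.partition ε₀) x' y' s' := by
  have hbranch := (tendsto_fst.prodMk_nhds
    ((h.pattern.tendsto_kktPoint (y := y)).comp tendsto_snd)).eventually
    (hχ.eventually_eq_of_kktMap_eq_zero h)
  obtain ⟨T, hT, U, hU, hTU⟩ := eventually_prod_iff.1 hbranch
  filter_upwards [hT, h.eventually_exists_of_partition_eq hU] with t ht hexists hpart
  obtain ⟨x', y', s', hmem, h'⟩ := hexists hpart
  exact ⟨x', y', s', h', (hTU ht hmem (h'.pattern.kktMap_kktPoint h'.isComplSol)).symm⟩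

theorem partitionConstNear_iff : S.PartitionConstNear ε₀ ↔
    ∀ᶠ t in 𝓝 ε₀, t ∈ S.dom ∧ S.partition t = S.partition ε₀ := by
  constructor
  · rintro ⟨δ, hδ, hdom, hconst⟩
    filter_upwards [Ioo_mem_nhds (sub_lt_self ε₀ hδ) (lt_add_of_pos_right ε₀ hδ)] with t ht
    exact ⟨interior_subset (hdom ht), hconst t ht⟩
  · intro h
    obtain ⟨δ, hδ, hball⟩ := Metric.eventually_nhds_iff_ball.1 h
    rw [Real.ball_eq_Ioo] at hball
    exact ⟨δ, hδ, interior_maximal (fun t ht => (hball t ht).1) isOpen_Ioo,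
      fun t ht => (hball t ht).2⟩

theorem IsSolutionMap.partitionConstNear_iff_derivativesVanish
    {χ : ℝ → KKTVar m d (S.partition ε₀)} (hχ : S.IsSolutionMap ε₀ ρ χ)
    (h : S.IsNondegSol (S.partition ε₀) ε₀ x y s) :
    S.PartitionConstNear ε₀ ↔ S.DerivativesVanish ε₀ χ := by
  rw [derivativesVanish_iff hχ.analyticAt
    (hχ.apply_self h ▸ h.pattern.hasDegenerateBlocks_kktPoint), partitionConstNear_iff]
  constructor <;> intro hnear
  · filter_upwards [hnear, hχ.eventually_eq_kktPoint h] with t ht hpoint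
    obtain ⟨x', y', s', h', heq⟩ := hpoint ht.2
    exact heq ▸ h'.pattern.hasDegenerateBlocks_kktPoint
  · filter_upwards [hnear, hχ.eventually_kktMap_eq_zero,
      (hχ.tendsto_kktPoint h).eventually h.eventually_of_kktMap_eq_zero] with t hdeg hzero hsol
    have h' := hsol t hzero hdeg
    exact ⟨h'.isComplSol.mem_dom, h'.partition_eq⟩

end Persistence

section NonlinearityIntervals

theorem IsNonlinearityInterval.partitionConstNear {J : Set ℝ} (hJ : S.IsNonlinearityInterval J)
    (h₀ : ε₀ ∈ J) : S.PartitionConstNear ε₀ := by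
  obtain ⟨-, hopen, -, hdom, hconst, -, -⟩ := hJ
  refine partitionConstNear_iff.2 ?_
  filter_upwards [hopen.mem_nhds h₀] with t ht
  exact ⟨interior_subset (hdom ht), hconst t ht ε₀ h₀⟩

theorem PartitionConstNear.exists_isNonlinearityInterval (h : S.PartitionConstNear ε₀)
    (hinv : ¬ ∃ J, S.IsInvariancyInterval J ∧ ε₀ ∈ J) :
    ∃ J, S.IsNonlinearityInterval J ∧ ε₀ ∈ J := by
  obtain ⟨δ, hδ, hdom, hconst⟩ := h
  let F : Set (Set ℝ) := {J | IsOpen J ∧ J.OrdConnected ∧ J ⊆ interior S.dom ∧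
    S.PartitionConstOn J ∧ ε₀ ∈ J}
  have hball : Ioo (ε₀ - δ) (ε₀ + δ) ∈ F :=
    ⟨isOpen_Ioo, ordConnected_Ioo, hdom, fun a ha b hb => (hconst a ha).trans (hconst b hb).symm,
      sub_lt_self _ hδ, lt_add_of_pos_right _ hδ⟩
  have hmem : ε₀ ∈ ⋃₀ F := ⟨_, hball, hball.2.2.2.2⟩
  have hopen : IsOpen (⋃₀ F) := isOpen_sUnion fun J hJ => hJ.1
  have hord : (⋃₀ F).OrdConnected :=
    (isPreconnected_sUnion ε₀ F (fun J hJ => hJ.2.2.2.2)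
      fun J hJ => hJ.2.1.isPreconnected).ordConnected
  have hsub : ⋃₀ F ⊆ interior S.dom := sUnion_subset fun J hJ => hJ.2.2.1
  have hpart : S.PartitionConstOn (⋃₀ F) := by
    rintro a ⟨J, hJ, ha⟩ b ⟨K, hK, hb⟩
    exact (hJ.2.2.2.1 a ha ε₀ hJ.2.2.2.2).trans (hK.2.2.2.1 b hb ε₀ hK.2.2.2.2).symm
  have hrays : ¬ S.RaysConstOn (⋃₀ F) := fun hrays =>
    hinv ⟨_, ⟨⟨ε₀, hmem⟩, hopen, hord, hsub, hpart, hrays⟩, hmem⟩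
  refine ⟨⋃₀ F, ⟨⟨ε₀, hmem⟩, hopen, hord, hsub, hpart, hrays, fun J ho hc hs hp hle => ?_⟩, hmem⟩
  exact (subset_sUnion_of_mem (show J ∈ F from ⟨ho, hc, hs, hp, hle hmem⟩)).antisymm hle

end NonlinearityIntervals

end ParamSOCO

theorem mainTheorem1_general {m p : ℕ} {d : Fin p → ℕ} (S : ParamSOCO m p d) (ε₀ : ℝ)
    (hnd : S.NondegenerateAt ε₀) :
    (∃! x, x ∈ S.primalOpt ε₀) ∧ (∃! q, q ∈ S.dualOpt ε₀) ∧
    (∃ ρ χ, S.IsSolutionMap ε₀ ρ χ) ∧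
    (∀ ρ χ₁ χ₂, S.IsSolutionMap ε₀ ρ χ₁ → S.IsSolutionMap ε₀ ρ χ₂ →
      Set.EqOn χ₁ χ₂ (Set.Ioo (ε₀ - ρ) (ε₀ + ρ))) ∧
    ∀ ρ χ, S.IsSolutionMap ε₀ ρ χ →
      (S.PartitionConstNear ε₀ ↔ S.DerivativesVanish ε₀ χ) ∧
      ((¬ ∃ J, S.IsInvariancyInterval J ∧ ε₀ ∈ J) →
        ((∃ J, S.IsNonlinearityInterval J ∧ ε₀ ∈ J) ↔ S.DerivativesVanish ε₀ χ)) := by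
  obtain ⟨x, y, s, h⟩ := hnd.exists_isNondegSol
  refine ⟨⟨x, h.isComplSol.mem_primalOpt, h.primal_unique⟩,
    ⟨(y, s), h.isComplSol.mem_dualOpt, h.dual_unique⟩, h.exists_isSolutionMap,
    fun ρ χ₁ χ₂ hχ₁ hχ₂ => hχ₁.eqOn hχ₂ h, fun ρ χ hχ => ?_⟩
  have hiff := hχ.partitionConstNear_iff_derivativesVanish h
  exact ⟨hiff, fun hinv => ⟨fun ⟨_, hJ, h₀⟩ => hiff.1 (hJ.partitionConstNear h₀),
    fun hder => (hiff.2 hder).exists_isNonlinearityInterval hinv⟩⟩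

theorem mainTheorem1 {m p : ℕ} {d : Fin p → ℕ} (S : ParamSOCO m p d)
    (hIPC : S.InteriorPointCondition) (ε₀ : ℝ) (hnd : S.NondegenerateAt ε₀) :
    (∃! x, x ∈ S.primalOpt ε₀) ∧ (∃! q, q ∈ S.dualOpt ε₀) ∧
    (∃ ρ χ, S.IsSolutionMap ε₀ ρ χ) ∧
    (∀ ρ χ₁ χ₂, S.IsSolutionMap ε₀ ρ χ₁ → S.IsSolutionMap ε₀ ρ χ₂ →
      Set.EqOn χ₁ χ₂ (Set.Ioo (ε₀ - ρ) (ε₀ + ρ))) ∧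
    ∀ ρ χ, S.IsSolutionMap ε₀ ρ χ →
      (S.PartitionConstNear ε₀ ↔ S.DerivativesVanish ε₀ χ) ∧
      ((¬ ∃ J, S.IsInvariancyInterval J ∧ ε₀ ∈ J) →
        ((∃ J, S.IsNonlinearityInterval J ∧ ε₀ ∈ J) ↔ S.DerivativesVanish ε₀ χ)) :=
  mainTheorem1_general S ε₀ hnd
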